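/- There are an absolute constant $C>0$ and an integer $k\ge 0$ such that the following holds. Write $\widetilde{\mathcal O}(g)$ for a quantity bounded by $C\,g\,(\log(2+g))^{k}$ and $\mathcal O(g)$ for one bounded by $C\,g$. Let $n\ge 1$, $\eta>0$, $0<\gamma\le 1$, $\Delta>0$, $\mu\in\mathbb R$ and $0<\epsilon<1$ be given. There is a quantum algorithm on $n$ system qubits and two ancilla qubits, depending only on $(n,\eta,\gamma,\Delta,\mu,\epsilon)$, which uses arbitrary one- and two-qubit gates, single-qubit measurements whose outcomes may control later steps, restarts from the all-zero state, and queries to black-box unitaries $U$ (plain or controlled on an ancilla qubit) and $U_I$ and to their inverses, with the following property. Let $H$ be any $n$-qubit Hamiltonian with spectrum in $[\eta,\pi-\eta]$, with a normalised nondegenerate ground state $|\psi_0\rangle$, ground-state energy $\lambda_0$ and first excited energy $\lambda_1$ such that $\lambda_1-\lambda_0\ge\Delta$ and $\lambda_0\le\mu-\Delta/2<\mu+\Delta/2\le\lambda_1$. Let $U=e^{-iH}$, and let $U_I$ be any unitary such that $|\phi_0\rangle=U_I|0^n\rangle$ satisfies $|\langle\phi_0|\psi_0\rangle|\ge\gamma$.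 Then, run with these black boxes, the algorithm reports success with probability at least $2/3$, and whenever it reports success its final state is $|0^2\rangle\otimes|\widetilde\psi_0\rangle$, up to a phase, for a unit vector $|\widetilde\psi_0\rangle$ with $|\langle\psi_0|\widetilde\psi_0\rangle|\ge 1-\epsilon$. In the worst case over the measurement outcomes, the cost of the algorithm is: 1. $\widetilde{\mathcal O}(\gamma^{-1}\Delta^{-1}\log(2\epsilon^{-1}))$ queries to (controlled-) $U$ and $\mathcal O(\gamma^{-1})$ queries to $U_I$ (queries to inverses included); 2. two ancilla qubits; 3. $\widetilde{\mathcal O}(n\gamma^{-1}\Delta^{-1}\log(2\epsilon^{-1}))$ additional one- and two-qubit gates (a measurement counted as one gate, and a restart as one gate per qubit); 4. query depth $\widetilde{\mathcal O}(\gamma^{-1}\Delta^{-1}\log(2\epsilon^{-1}))$ for $U$, that is, the largest number of queries to $U$ between two consecutive (re)starts. -/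

import Mathlib

open scoped Matrix

noncomputable section

namespace GroundStatePrep

/-! ### Qubit registers -/

/-- Computational basis labels of the `n`-qubit system register. -/
abbrev SysBasis (n : ℕ) : Type := Fin n → Fin 2

/-- The wires of a computer with `m` ancilla qubits and `n` system qubits. -/
abbrev Wire (m n : ℕ) : Type := Fin m ⊕ Fin n

/-- (Unnormalised) state vectors on all `m + n` qubits. Before a state is renormalised, its squared
norm is the probability of the measurement record that led to it. -/
abbrev State (m n : ℕ) : Type := (Wire m n → Fin 2) → ℂ

/-- Squared norm of a state vector. -/
def State.weight {m n : ℕ} (ψ : State m n) : ℝ := ∑ x, ‖ψ x‖ ^ 2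

/-- The system state `|0^n⟩`. -/
def sysZero (n : ℕ) : SysBasis n → ℂ := Pi.single (fun _ => 0) 1

/-- The state `|0^m⟩ ⊗ |φ⟩`. -/
def withZeroAncilla (m : ℕ) {n : ℕ} (φ : SysBasis n → ℂ) : State m n := fun x =>
  if ∀ i : Fin m, x (Sum.inl i) = 0 then φ (fun j => x (Sum.inr j)) else 0

/-- The initial state `|0^m⟩ ⊗ |0^n⟩`. -/
def State.init (m n : ℕ) : State m n := withZeroAncilla m (sysZero n)

/-- Action of a one-qubit matrix on the wire `q`. -/
def applyOne {m n : ℕ} (q : Wire m n) (V : Matrix (Fin 2) (Fin 2) ℂ) (ψ : State m n) :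
    State m n := fun x =>
  ∑ b, V (x q) b * ψ (Function.update x q b)

/-- Action of a two-qubit matrix on the ordered pair of wires `(q, r)`. -/
def applyTwo {m n : ℕ} (q r : Wire m n) (V : Matrix (Fin 2 × Fin 2) (Fin 2 × Fin 2) ℂ)
    (ψ : State m n) : State m n := fun x =>
  ∑ b, ∑ c, V (x q, x r) (b, c) * ψ (Function.update (Function.update x q b) r c)

/-- Action of `I ⊗ A`, the matrix `A` acting on the system register. -/
def applySys {m n : ℕ} (A : Matrix (SysBasis n) (SysBasis n) ℂ) (ψ : State m n) :
    State m n := fun x =>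
  ∑ y, A (fun j => x (Sum.inr j)) y * ψ (Sum.elim (fun i => x (Sum.inl i)) y)

/-- Action of the matrix `A` on the system register, controlled on the ancilla `a`. -/
def applyCtrlSys {m n : ℕ} (a : Fin m) (A : Matrix (SysBasis n) (SysBasis n) ℂ)
    (ψ : State m n) : State m n := fun x =>
  if x (Sum.inl a) = 1 then applySys A ψ x else ψ x

/-- The projection onto the outcome `b` of a computational basis measurement of the wire `q`. -/
def project {m n : ℕ} (q : Wire m n) (b : Fin 2) (ψ : State m n) : State m n := fun x =>
  if x q = b then ψ x else 0

/-! ### Programs with black-box oracles -/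

/-- The coherent operations: arbitrary one- and two-qubit gates, and queries to the black boxes
`U`, controlled-`U` and `U_I`, or (with `inv = true`) to their inverses. -/
inductive Op (m n : ℕ) : Type
  | one (q : Wire m n) (V : Matrix.unitaryGroup (Fin 2) ℂ) : Op m n
  | two (q r : Wire m n) (hqr : q ≠ r) (V : Matrix.unitaryGroup (Fin 2 × Fin 2) ℂ) : Op m n
  | queryU (inv : Bool) : Op m n
  | queryCtrlU (a : Fin m) (inv : Bool) : Op m n
  | queryUI (inv : Bool) : Op m n

/-- `A`, or its adjoint. -/
def maybeAdjoint {n : ℕ} (inv : Bool) (A : Matrix (SysBasis n) (SysBasis n) ℂ) :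
    Matrix (SysBasis n) (SysBasis n) ℂ := if inv then Aᴴ else A

/-- Action of an operation on states, for given values `U` and `UI` of the black boxes. -/
def Op.apply {m n : ℕ} (U UI : Matrix (SysBasis n) (SysBasis n) ℂ) :
    Op m n → State m n → State m n
  | .one q V => applyOne q V.1
  | .two q r _ V => applyTwo q r V.1
  | .queryU inv => applySys (maybeAdjoint inv U)
  | .queryCtrlU a inv => applyCtrlSys a (maybeAdjoint inv U)
  | .queryUI inv => applySys (maybeAdjoint inv UI)

/-- Adaptive quantum programs on `m + n` qubits: apply an operation, measure a qubit in the
computational basis and branch on the outcome, start a new coherent run with all qubits reset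
to `|0⟩`, or halt and report success or failure. A program refers to the black boxes only through
queries. -/
inductive Program (m n : ℕ) : Type
  | halt (success : Bool) : Program m n
  | op (g : Op m n) (next : Program m n) : Program m n
  | measure (q : Wire m n) (next : Fin 2 → Program m n) : Program m n
  | restart (next : Program m n) : Program m n

/-- The probability (times the squared norm of the current state) that the program halts and
reports success. -/
def Program.successProb {m n : ℕ} (U UI : Matrix (SysBasis n) (SysBasis n) ℂ) :
    Program m n → State m n → ℝ
  | .halt s, ψ => if s then ψ.weight else 0
  | .op g P, ψ => P.successProb U UI (g.apply U UI ψ)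
  | .measure q P, ψ => ∑ b, (P b).successProb U UI (project q b ψ)
  | .restart P, ψ => ψ.weight * P.successProb U UI (State.init m n)

/-- Whenever the program reports success (with nonzero probability), the final state of the
computer has the property `Good`. -/
def Program.SuccessImplies {m n : ℕ} (U UI : Matrix (SysBasis n) (SysBasis n) ℂ)
    (Good : State m n → Prop) : Program m n → State m n → Prop
  | .halt s, ψ => s = true → ψ ≠ 0 → Good ψ
  | .op g P, ψ => P.SuccessImplies U UI Good (g.apply U UI ψ)
  | .measure q P, ψ => ∀ b, (P b).SuccessImplies U UI Good (project q b ψ)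
  | .restart P, ψ => ψ ≠ 0 → P.SuccessImplies U UI Good (State.init m n)

/-! ### Costs, in the worst case over all measurement outcomes -/

/-- Total cost of a program in which an operation `g` costs `c g`, a measurement costs `cMeas`
and a reset of the computer costs `cReset`. -/
def Program.cost {m n : ℕ} (c : Op m n → ℕ) (cMeas cReset : ℕ) : Program m n → ℕ
  | .halt _ => 0
  | .op g P => c g + P.cost c cMeas cReset
  | .measure _ P => cMeas + max ((P 0).cost c cMeas cReset) ((P 1).cost c cMeas cReset)
  | .restart P => cReset + P.cost c cMeas cReset

/-- Number of queries to `U` or controlled-`U` (or an inverse) in an operation. -/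
def Op.uCost {m n : ℕ} : Op m n → ℕ
  | .one _ _ => 0
  | .two _ _ _ _ => 0
  | .queryU _ => 1
  | .queryCtrlU _ _ => 1
  | .queryUI _ => 0

/-- Number of queries to `U_I` (or its inverse) in an operation. -/
def Op.uiCost {m n : ℕ} : Op m n → ℕ
  | .one _ _ => 0
  | .two _ _ _ _ => 0
  | .queryU _ => 0
  | .queryCtrlU _ _ => 0
  | .queryUI _ => 1

/-- Number of one- and two-qubit gates in an operation. -/
def Op.gateCost {m n : ℕ} : Op m n → ℕ
  | .one _ _ => 1
  | .two _ _ _ _ => 1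
  | .queryU _ => 0
  | .queryCtrlU _ _ => 0
  | .queryUI _ => 0

/-- Total number of queries to (controlled-) `U`. -/
def Program.uQueries {m n : ℕ} (P : Program m n) : ℕ := P.cost Op.uCost 0 0

/-- Total number of queries to `U_I`. -/
def Program.uiQueries {m n : ℕ} (P : Program m n) : ℕ := P.cost Op.uiCost 0 0

/-- Total number of additional one- and two-qubit gates. A measurement is counted as one gate,
and a reset of the computer as one gate per qubit. -/
def Program.extraGates {m n : ℕ} (P : Program m n) : ℕ := P.cost Op.gateCost 1 (m + n)

/-- Largest number of queries to (controlled-) `U` in one coherent run, if `k` queries have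
already been made in the current run. -/
def Program.uDepthFrom {m n : ℕ} : Program m n → ℕ → ℕ
  | .halt _, k => k
  | .op g P, k => P.uDepthFrom (k + g.uCost)
  | .measure _ P, k => max ((P 0).uDepthFrom k) ((P 1).uDepthFrom k)
  | .restart P, k => max k (P.uDepthFrom 0)

/-- Query depth: the largest number of queries to (controlled-) `U` in one coherent run. -/
def Program.uDepth {m n : ℕ} (P : Program m n) : ℕ := P.uDepthFrom 0

/-! ### The ground-state preparation problem -/

/-- The time evolution `e^{-iH}`. -/
def evolution {n : ℕ} (H : Matrix (SysBasis n) (SysBasis n) ℂ) :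
    Matrix (SysBasis n) (SysBasis n) ℂ := NormedSpace.exp ((-Complex.I) • H)

/-- `H` is an `n`-qubit Hamiltonian with spectrum in `[η, π - η]`, `ψ₀` is its normalised ground
state with energy `E₀`, `E₁` is the energy of the first excited state, the gap is at least `Δ`,
`E₀ ≤ μ - Δ/2 < μ + Δ/2 ≤ E₁`, and `UI` is a unitary that prepares a state `UI |0^n⟩` of overlap
at least `γ` with `ψ₀`. -/
structure IsInstance {n : ℕ} (η γ Δ μ : ℝ) (H UI : Matrix (SysBasis n) (SysBasis n) ℂ)
    (ψ₀ : SysBasis n → ℂ) (E₀ E₁ : ℝ) : Prop where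
  hermitian : H.IsHermitian
  spectrum_subset : spectrum ℝ H ⊆ Set.Icc η (Real.pi - η)
  energy_isLeast : IsLeast (spectrum ℝ H) E₀
  ground_norm : star ψ₀ ⬝ᵥ ψ₀ = 1
  ground_eigen : H *ᵥ ψ₀ = (E₀ : ℂ) • ψ₀
  excited_isLeast :
    IsLeast {E : ℝ | ∃ v : SysBasis n → ℂ, v ≠ 0 ∧ star ψ₀ ⬝ᵥ v = 0 ∧ H *ᵥ v = (E : ℂ) • v} E₁
  gap : Δ ≤ E₁ - E₀
  energy_le : E₀ ≤ μ - Δ / 2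
  le_excited : μ + Δ / 2 ≤ E₁
  unitary : UI ∈ Matrix.unitaryGroup (SysBasis n) ℂ
  overlap : γ ≤ ‖star (UI *ᵥ sysZero n) ⬝ᵥ ψ₀‖

/-- Up to normalisation, the final state is `|0^m⟩ ⊗ |φ⟩` for a unit vector `φ` with
`|⟨ψ₀|φ⟩| ≥ 1 - ε`. -/
def IsPrepared {m n : ℕ} (ε : ℝ) (ψ₀ : SysBasis n → ℂ) (ψ : State m n) : Prop :=
  ∃ (c : ℂ) (φ : SysBasis n → ℂ), ψ = c • withZeroAncilla m φ ∧ star φ ⬝ᵥ φ = 1 ∧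
    1 - ε ≤ ‖star ψ₀ ⬝ᵥ φ‖

/-- The program prepares `ψ₀` up to fidelity `1 - ε` with probability at least `p`. -/
def Program.Prepares {m n : ℕ} (P : Program m n) (U UI : Matrix (SysBasis n) (SysBasis n) ℂ)
    (ε p : ℝ) (ψ₀ : SysBasis n → ℂ) : Prop :=
  p ≤ P.successProb U UI (State.init m n) ∧
    P.SuccessImplies U UI (IsPrepared ε ψ₀) (State.init m n)

/-- The bound `C g (log (2 + g))^k` that expresses `Õ(g) = O(g polylog g)`. -/
def softBound (C : ℝ) (k : ℕ) (g : ℝ) : ℝ := C * g * Real.log (2 + g) ^ k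

end GroundStatePrep

end

namespace GroundStatePrep

open Polynomial

/-! ### Polynomials on the unit circle -/

/-! The program filters `UI |0^n⟩` by a polynomial in `U`, amplifies the surviving part, and
repeats.

Filter. There is a polynomial `P` of degree `O(Δ⁻¹ log (1 / (εγΔ)))`, at most `1/2` in modulus on
the unit circle, with `|P(e^{-iλ})| ≥ 1/4` for `λ ≤ μ - Δ/2` and `|P(e^{-iλ})| ≤ εγ/4` for `λ ≥ μ +
Δ/2` (`exists_lowPass`). It is a partial sum of rotated copies of a concentrated kernel whose full
sum is constant by Parseval. Since the ground component of `UI |0^n⟩` is at least `γ`, the vector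
`P(U) UI |0^n⟩` has ground component at least `γ/4` and an orthogonal part of norm at most `εγ/4`.
After normalisation its overlap with the ground state is therefore at least `1 - ε`
(`IsInstance.filtered`, `isPrepared_smul`).

Circuit. Fejér–Riesz factorisation supplies `Q` with `|P|² + |Q|² = 1` on the circle
(`exists_complement`), and peeling off one rotation per degree writes `(P, Q)` as a product of
rotations and `diag (1, X)` (`exists_signalPair_eq`). With `X` replaced by controlled-`U`, one
ancilla implements `P(U)`, flagged by the outcome `0` (`runOps_signalOps`).

Amplification. One round maps the success probability `sin² θ` to `sin² (3θ)` and only rescales the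
flagged part, so the fidelity does not depend on the depth (`goodPart_runOps_amplify`). The angle is
unknown, so every depth `0, …, K` with `3 ^ K = O(γ⁻¹)` is tried. At one of them the probability is
at least `1/4`, and four sweeps fail with probability at most `(3/4)⁴ < 1/3` (`successProb_sweeps`).
The costs of the depths form a geometric series, so no logarithm of `γ⁻¹` is lost.

Second ancilla. The reflection about the zero state has `n + 1` controls. Splitting them into two
halves, each lending its qubits to the other, gives `O(n)` gates with this single further qubit
(`runOps_zeroReflection`). -/

theorem mul_star_eq_norm_sq (z : ℂ) : z * star z = ((‖z‖ ^ 2 : ℝ) : ℂ) := by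
  rw [Complex.star_def, Complex.mul_conj, Complex.normSq_eq_norm_sq]

/-- The polynomial `X ^ d * conj (p (1 / conj X))`. -/
noncomputable def conjReflect (d : ℕ) (p : ℂ[X]) : ℂ[X] := reflect d (p.map (starRingEnd ℂ))

theorem eval_conjReflect {d : ℕ} {p : ℂ[X]} (hp : p.natDegree ≤ d) {z : ℂ} (hz : z ≠ 0) :
    (conjReflect d p).eval z = z ^ d * star (p.eval (star z)⁻¹) := by
  let _ : Invertible z⁻¹ := ⟨z, mul_inv_cancel₀ hz, inv_mul_cancel₀ hz⟩
  have h : eval z (conjReflect d p) * z⁻¹ ^ d = eval z⁻¹ (p.map (starRingEnd ℂ)) :=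
    eval₂_reflect_mul_pow (RingHom.id ℂ) (z⁻¹) d (p.map (starRingEnd ℂ))
      (by rw [natDegree_map]; exact hp)
  have h2 : eval z⁻¹ (p.map (starRingEnd ℂ)) = star (p.eval (star z)⁻¹) := by
    have h3 := hom_eval₂ p (RingHom.id ℂ) (starRingEnd ℂ) (star z)⁻¹
    rw [RingHom.comp_id, map_inv₀, Complex.star_def, Complex.conj_conj] at h3
    rw [eval_map, ← h3]
    rfl
  rw [← h2, ← h, mul_comm, mul_assoc, ← mul_pow, inv_mul_cancel₀ hz, one_pow, mul_one]

theorem eval_conjReflect_of_norm_eq_one {d : ℕ} {p : ℂ[X]} (hp : p.natDegree ≤ d) {z : ℂ}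
    (hz : ‖z‖ = 1) : (conjReflect d p).eval z = z ^ d * star (p.eval z) := by
  have hz0 : z ≠ 0 := by rintro rfl; simp at hz
  rw [eval_conjReflect hp hz0]
  congr 3
  rw [inv_eq_iff_eq_inv, Complex.inv_def, Complex.normSq_eq_norm_sq, hz]
  simp

theorem coeff_conjReflect {d : ℕ} {p : ℂ[X]} {i : ℕ} (hi : i ≤ d) :
    (conjReflect d p).coeff i = star (p.coeff (d - i)) := by
  simp [conjReflect, coeff_reflect, revAt_le hi]

theorem natDegree_conjReflect_le {d : ℕ} {p : ℂ[X]} (hp : p.natDegree ≤ d) :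
    (conjReflect d p).natDegree ≤ d :=
  natDegree_reflect_le.trans (max_le le_rfl (natDegree_map_le.trans hp))

theorem infinite_norm_eq_one : {z : ℂ | ‖z‖ = 1}.Infinite := by
  refine Set.infinite_of_injOn_mapsTo (f := fun t : ℝ => Complex.exp (t * Complex.I))
    (s := Set.Ioc (-Real.pi) Real.pi) ?_ ?_ (Set.Ioc_infinite (by linarith [Real.pi_pos]))
  · intro s hs t ht h
    have := Complex.exp_inj_of_neg_pi_lt_of_le_pi (by simpa using hs.1) (by simpa using hs.2)
      (by simpa using ht.1) (by simpa using ht.2) h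
    simpa using this
  · intro t _
    exact Complex.norm_exp_ofReal_mul_I t

/-- This turns identities that involve `star`, which make sense only on the circle, into identities
of coefficients. -/
theorem eq_of_eval_eq_on_circle {p q : ℂ[X]} (h : ∀ z : ℂ, ‖z‖ = 1 → p.eval z = q.eval z) :
    p = q :=
  eq_of_infinite_eval_eq p q (infinite_norm_eq_one.mono h)

/-- A Laurent polynomial that is positive on the unit circle is the square of the modulus of a
polynomial there. -/
theorem exists_eval_eq_norm_sq (d : ℕ) : ∀ (p : ℂ[X]), p.natDegree ≤ 2 * d →
    (∀ z : ℂ, ‖z‖ = 1 → ∃ r : ℝ, 0 < r ∧ p.eval z = z ^ d * r) →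
    ∃ q : ℂ[X], q.natDegree ≤ d ∧ ∀ z : ℂ, ‖z‖ = 1 → p.eval z = z ^ d * (‖q.eval z‖ ^ 2 : ℝ) := by
  induction d with
  | zero =>
    intro p hp hpos
    obtain ⟨c, rfl⟩ := natDegree_eq_zero.1 (Nat.le_zero.1 hp)
    obtain ⟨r, hr, h⟩ := hpos 1 (by simp)
    refine ⟨C (√r : ℂ), by simp, fun z _ => ?_⟩
    simp only [eval_C, pow_zero, one_mul] at h ⊢
    rw [h, Complex.norm_real, Real.norm_eq_abs, sq_abs, Real.sq_sqrt hr.le]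
  | succ d ih =>
    intro p hp hpos
    -- Since `z ^ (-(d + 1)) * p z` is real on the circle, `p` is self-reciprocal: its coefficients
    -- are symmetric up to conjugation, and its nonzero roots come in pairs `r`, `1 / star r`.
    have hself : conjReflect (2 * (d + 1)) p = p := by
      refine eq_of_eval_eq_on_circle fun z hz => ?_
      obtain ⟨r, -, h⟩ := hpos z hz
      rw [eval_conjReflect_of_norm_eq_one hp hz, h]
      have hzz : z * star z = 1 := by
        rw [mul_star_eq_norm_sq, hz]; simp
      have : z ^ (d + 1) * star z ^ (d + 1) = 1 := by rw [← mul_pow, hzz, one_pow]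
      simp only [star_mul', star_pow, Complex.star_def, Complex.conj_ofReal] at this ⊢
      linear_combination z ^ (d + 1) * r * this
    -- If the constant coefficient vanishes, so does the top one by symmetry, and dividing by `X`
    -- lowers `d` by one. Otherwise a pair of roots is split off.
    by_cases h0 : p.coeff 0 = 0
    · have htop : p.coeff (2 * (d + 1)) = 0 := by
        rw [← hself, coeff_conjReflect le_rfl]; simp [h0]
      obtain ⟨p', rfl⟩ := X_dvd_iff.2 h0
      have hp' : p'.natDegree ≤ 2 * d := by
        rw [natDegree_le_iff_coeff_eq_zero]
        intro N hN
        rw [← coeff_X_mul]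
        rcases eq_or_lt_of_le (show 2 * (d + 1) ≤ N + 1 by omega) with h | h
        · rw [← h, htop]
        · exact coeff_eq_zero_of_natDegree_lt (hp.trans_lt h)
      obtain ⟨q, hq, hpq⟩ := ih p' hp' fun z hz => by
        obtain ⟨r, hr, h⟩ := hpos z hz
        have hz0 : z ≠ 0 := by rintro rfl; simp at hz
        refine ⟨r, hr, mul_left_cancel₀ hz0 ?_⟩
        rw [eval_mul, eval_X] at h
        rw [h]; ring
      refine ⟨q, hq.trans d.le_succ, fun z hz => ?_⟩
      rw [eval_mul, eval_X, hpq z hz]; ring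
    · have hdeg : p.natDegree = 2 * (d + 1) := by
        refine natDegree_eq_of_le_of_coeff_ne_zero hp ?_
        rw [← hself, coeff_conjReflect le_rfl]; simpa using h0
      obtain ⟨r, hr⟩ := IsAlgClosed.exists_root p (by
        rw [degree_eq_natDegree (by rintro rfl; simp at h0), hdeg]
        exact_mod_cast (by omega : 2 * (d + 1) ≠ 0))
      have hr0 : r ≠ 0 := by
        rintro rfl
        exact h0 (by rw [coeff_zero_eq_eval_zero]; exact hr)
      -- Strict positivity keeps the roots off the circle, so `r` and its mirror image are distinct
      -- and multiplicities need no discussion.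
      have hr1 : ‖r‖ ≠ 1 := fun h => by
        obtain ⟨s, hs, h'⟩ := hpos r h
        rw [hr.eq_zero] at h'
        simp [hr0, hs.ne'] at h'
      have hsr0 : star r ≠ 0 := by simpa using hr0
      have hr' : p.IsRoot (star r)⁻¹ := by
        rw [IsRoot, ← hself, eval_conjReflect hp (inv_ne_zero hsr0)]
        simp [hr.eq_zero]
      obtain ⟨p₁, rfl⟩ := dvd_iff_isRoot.2 hr
      have hne : (star r)⁻¹ - r ≠ 0 := by
        intro h
        have h2 : star r * r = 1 := by
          nth_rw 2 [← sub_eq_zero.1 h]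
          rw [mul_inv_cancel₀ hsr0]
        apply hr1
        have := congrArg norm h2
        rw [norm_mul, norm_star, norm_one] at this
        nlinarith [norm_nonneg r]
      obtain ⟨p₂, rfl⟩ : X - C (star r)⁻¹ ∣ p₁ := by
        rw [dvd_iff_isRoot, IsRoot]
        rw [IsRoot, eval_mul] at hr'
        rw [eval_sub, eval_X, eval_C] at hr'
        exact (mul_eq_zero.1 hr').resolve_left hne
      have hp₂0 : p₂ ≠ 0 := by rintro rfl; simp at h0
      -- On the circle the pair of factors is, up to the constant `-(star r)⁻¹`, equal to `z` times
      -- the positive number `‖z - r‖ ^ 2`.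
      have key : ∀ z : ℂ, ‖z‖ = 1 →
          (z - r) * (z - (star r)⁻¹) = z * (‖z - r‖ ^ 2 : ℝ) * (-(star r)⁻¹) := by
        intro z hz
        have hzz : z * star z = 1 := by
          rw [mul_star_eq_norm_sq, hz]; simp
        rw [← mul_star_eq_norm_sq, star_sub]
        field_simp
        linear_combination (z - r) * hzz
      have hz1 : ∀ z : ℂ, ‖z‖ = 1 → 0 < ‖z - r‖ ^ 2 := fun z hz => by
        have : z - r ≠ 0 := by
          intro h
          exact hr1 (by rw [← sub_eq_zero.1 h, hz])
        positivity
      -- The constant is moved to the cofactor, so that the cofactor is again `z ^ d` times a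
      -- positive number.
      obtain ⟨q, hq, hpq⟩ := ih (C (-(star r)⁻¹) * p₂) (by
          refine (natDegree_C_mul_le _ _).trans ?_
          rw [natDegree_mul (X_sub_C_ne_zero _) (mul_ne_zero (X_sub_C_ne_zero _) hp₂0),
            natDegree_mul (X_sub_C_ne_zero _) hp₂0, natDegree_X_sub_C, natDegree_X_sub_C] at hdeg
          omega) fun z hz => by
        obtain ⟨s, hs, h⟩ := hpos z hz
        have hz0 : z ≠ 0 := by rintro rfl; simp at hz
        refine ⟨s / ‖z - r‖ ^ 2, div_pos hs (hz1 z hz), ?_⟩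
        have h3 : ((‖z - r‖ ^ 2 : ℝ) : ℂ) ≠ 0 := by exact_mod_cast (hz1 z hz).ne'
        rw [Complex.ofReal_div]
        refine mul_left_cancel₀ (mul_ne_zero hz0 h3) ?_
        have h4 := key z hz
        simp only [eval_mul, eval_sub, eval_X, eval_C] at h ⊢
        rw [← mul_assoc, h4] at h
        rw [← mul_assoc, h, mul_comm (_ * _) (_ * _), mul_assoc (z^d), mul_comm z, ← mul_assoc _ _ z,
          div_mul_cancel₀ _ h3]
        ring
      refine ⟨(X - C r) * q, ?_, fun z hz => ?_⟩
      · refine natDegree_mul_le.trans ?_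
        rw [natDegree_X_sub_C]; omega
      · have h1 := hpq z hz
        have h4 := key z hz
        simp only [eval_mul, eval_sub, eval_X, eval_C] at h1 ⊢
        rw [← mul_assoc, h4, mul_assoc _ _ (eval z p₂), h1, norm_mul, mul_pow, Complex.ofReal_mul]
        ring

/-- Fejér–Riesz applied to `z ^ d (1 - |P|²)`, which agrees on the circle with the polynomial `X ^ d
- P * conjReflect d P`. The strict bound on `P` gives the positivity. -/
theorem exists_complement {d : ℕ} {P : ℂ[X]} (hP : P.natDegree ≤ d)
    (h : ∀ z : ℂ, ‖z‖ = 1 → ‖P.eval z‖ < 1) :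
    ∃ Q : ℂ[X], Q.natDegree ≤ d ∧ ∀ z : ℂ, ‖z‖ = 1 → ‖P.eval z‖ ^ 2 + ‖Q.eval z‖ ^ 2 = 1 := by
  have hev : ∀ z : ℂ, ‖z‖ = 1 →
      (X ^ d - P * conjReflect d P).eval z = z ^ d * ((1 - ‖P.eval z‖ ^ 2 : ℝ) : ℂ) := by
    intro z hz
    rw [eval_sub, eval_mul, eval_pow, eval_X, eval_conjReflect_of_norm_eq_one hP hz,
      Complex.ofReal_sub, ← mul_star_eq_norm_sq, Complex.ofReal_one]
    ring
  obtain ⟨Q, hQ, hPQ⟩ := exists_eval_eq_norm_sq d (X ^ d - P * conjReflect d P) (by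
    refine (natDegree_sub_le _ _).trans (max_le (by rw [natDegree_X_pow]; omega) ?_)
    have := natDegree_conjReflect_le hP
    exact natDegree_mul_le.trans (by omega)) fun z hz =>
      ⟨_, by nlinarith [h z hz, norm_nonneg (P.eval z)], hev z hz⟩
  refine ⟨Q, hQ, fun z hz => ?_⟩
  have hz0 : z ≠ 0 := by rintro rfl; simp at hz
  have := mul_left_cancel₀ (pow_ne_zero d hz0) ((hev z hz).symm.trans (hPQ z hz))
  have := Complex.ofReal_injective this
  linarith

/-! ### Generalised quantum signal processing -/

/-- The first column of the product of the rotations in the list, each preceded by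
`diag (1, X)`. -/
noncomputable def signalPair : List (Matrix.unitaryGroup (Fin 2) ℂ) → ℂ[X] × ℂ[X]
  | [] => (1, 0)
  | R :: l =>
    (C (R.1 0 0) * (signalPair l).1 + C (R.1 0 1) * (X * (signalPair l).2),
      C (R.1 1 0) * (signalPair l).1 + C (R.1 1 1) * (X * (signalPair l).2))

/-- If `u` is nonzero, `w` is `u` normalised. If `u` vanishes, any unit vector orthogonal to `v`
serves. -/
theorem exists_unit_vector_of_orthogonal (u₀ u₁ v₀ v₁ : ℂ) (h : star v₀ * u₀ + star v₁ * u₁ = 0) :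
    ∃ w₀ w₁ : ℂ, star w₀ * w₀ + star w₁ * w₁ = 1 ∧ w₀ * u₁ - w₁ * u₀ = 0 ∧
      star w₀ * v₀ + star w₁ * v₁ = 0 := by
  have normalise : ∀ a b : ℂ, a ≠ 0 ∨ b ≠ 0 → ∃ s : ℝ,
      star (s * a) * (s * a) + star (s * b) * (s * b) = 1 := by
    intro a b hab
    have hpos : 0 < ‖a‖ ^ 2 + ‖b‖ ^ 2 := by
      rcases hab with h | h
      · have := norm_pos_iff.2 h; positivity
      · have := norm_pos_iff.2 h; positivity
    refine ⟨(√(‖a‖ ^ 2 + ‖b‖ ^ 2))⁻¹, ?_⟩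
    rw [mul_comm (star _), mul_comm (star _), mul_star_eq_norm_sq, mul_star_eq_norm_sq,
      ← Complex.ofReal_add, norm_mul, norm_mul, mul_pow, mul_pow, ← mul_add, Complex.norm_real,
      norm_inv, inv_pow, Real.norm_eq_abs, sq_abs, Real.sq_sqrt hpos.le, inv_mul_cancel₀ hpos.ne',
      Complex.ofReal_one]
  by_cases hu : u₀ ≠ 0 ∨ u₁ ≠ 0
  · obtain ⟨s, hs⟩ := normalise _ _ hu
    refine ⟨s * u₀, s * u₁, hs, by ring, ?_⟩
    have h' := congrArg star h
    simp only [star_add, star_mul', star_star, star_zero] at h'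
    have hsr : star (s : ℂ) = s := Complex.conj_ofReal s
    rw [star_mul', star_mul', hsr]
    linear_combination (s : ℂ) * h'
  · push Not at hu
    obtain ⟨rfl, rfl⟩ := hu
    by_cases hv : -star v₁ ≠ 0 ∨ star v₀ ≠ 0
    · obtain ⟨s, hs⟩ := normalise _ _ hv
      refine ⟨s * -star v₁, s * star v₀, hs, by ring, ?_⟩
      simp only [star_mul', star_neg, star_star]
      ring
    · push Not at hv
      have h0 : v₀ = 0 := by simpa using hv.2
      have h1 : v₁ = 0 := by simpa using hv.1
      exact ⟨1, 0, by simp, by simp, by simp [h0, h1]⟩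

theorem mem_unitaryGroup_two (a b c d : ℂ) (h₁ : star a * a + star c * c = 1)
    (h₂ : star b * b + star d * d = 1) (h₃ : star a * b + star c * d = 0) :
    !![a, b; c, d] ∈ Matrix.unitaryGroup (Fin 2) ℂ := by
  rw [Matrix.mem_unitaryGroup_iff']
  have h₄ : star b * a + star d * c = 0 := by
    have := congrArg star h₃
    simpa [mul_comm] using this
  ext i j
  fin_cases i <;> fin_cases j <;>
    simpa [Matrix.mul_apply, Fin.sum_univ_two, Matrix.star_apply]

/-- Layer stripping. The vectors of leading and of constant coefficients of `(P, Q)` are orthogonal.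
In an orthonormal basis aligned with them, one component loses its top coefficient and the other its
constant one; dividing the latter by `X` lowers both degrees by one. The length is `d + 1`: the
innermost `diag (1, X)` fixes the start vector `(1, 0)`. -/
theorem exists_signalPair_eq (d : ℕ) : ∀ (P Q : ℂ[X]), P.natDegree ≤ d → Q.natDegree ≤ d →
    (∀ z : ℂ, ‖z‖ = 1 → ‖P.eval z‖ ^ 2 + ‖Q.eval z‖ ^ 2 = 1) →
    ∃ l : List (Matrix.unitaryGroup (Fin 2) ℂ), l.length = d + 1 ∧ signalPair l = (P, Q) := by
  induction d with
  | zero =>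
    intro P Q hP hQ h
    obtain ⟨p, rfl⟩ := natDegree_eq_zero.1 (Nat.le_zero.1 hP)
    obtain ⟨q, rfl⟩ := natDegree_eq_zero.1 (Nat.le_zero.1 hQ)
    have h1 := h 1 (by simp)
    simp only [eval_C] at h1
    have h1 : p * star p + q * star q = 1 := by
      rw [mul_star_eq_norm_sq, mul_star_eq_norm_sq]
      exact_mod_cast h1
    refine ⟨[⟨!![p, -star q; q, star p], mem_unitaryGroup_two _ _ _ _ ?_ ?_ ?_⟩], rfl, ?_⟩
    · linear_combination h1
    · simp only [star_neg, star_star]; linear_combination h1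
    · ring
    · simp [signalPair]
  | succ d ih =>
    intro P Q hP hQ h
    have hprod : conjReflect (d + 1) P * P + conjReflect (d + 1) Q * Q = X ^ (d + 1) := by
      refine eq_of_eval_eq_on_circle fun z hz => ?_
      have h1 := h z hz
      have h1 : eval z P * star (eval z P) + eval z Q * star (eval z Q) = 1 := by
        rw [mul_star_eq_norm_sq, mul_star_eq_norm_sq]
        exact_mod_cast h1
      simp only [eval_add, eval_mul, eval_pow, eval_X, eval_conjReflect_of_norm_eq_one hP hz,
        eval_conjReflect_of_norm_eq_one hQ hz]
      linear_combination z ^ (d + 1) * h1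
    -- Coefficient of `X ^ (2 (d + 1))` in `hprod`, which vanishes on the right because `2 (d + 1) ≠
    -- d + 1`.
    have horth : star (P.coeff 0) * P.coeff (d + 1) + star (Q.coeff 0) * Q.coeff (d + 1) = 0 := by
      have := congrArg (fun p => coeff p ((d + 1) + (d + 1))) hprod
      simp only [coeff_add] at this
      rw [coeff_mul_add_eq_of_natDegree_le (natDegree_conjReflect_le hP) hP,
        coeff_mul_add_eq_of_natDegree_le (natDegree_conjReflect_le hQ) hQ,
        coeff_conjReflect le_rfl, coeff_conjReflect le_rfl, coeff_X_pow, if_neg (by omega)] at this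
      simpa using this
    obtain ⟨w₀, w₁, hw, hwu, hwv⟩ := exists_unit_vector_of_orthogonal _ _ _ _ horth
    have hwC : C (star w₀) * C w₀ + C (star w₁) * C w₁ = 1 := by
      rw [← C_mul, ← C_mul, ← C_add, hw, C_1]
    obtain ⟨Q', hQ'⟩ : X ∣ C (star w₀) * P + C (star w₁) * Q := by
      rw [X_dvd_iff]; simpa using hwv
    -- `P'` is the component orthogonal to the leading coefficients, and `X * Q'` the one orthogonal
    -- to the constant coefficients.
    set P' := C w₀ * Q - C w₁ * P with hP'
    have hdP : P'.natDegree ≤ d := by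
      rw [natDegree_le_iff_coeff_eq_zero]
      intro N hN
      rcases eq_or_lt_of_le (show d + 1 ≤ N by omega) with h' | h'
      · rw [← h', hP']; simpa using hwu
      · rw [hP', coeff_sub, coeff_C_mul, coeff_C_mul, coeff_eq_zero_of_natDegree_lt (hP.trans_lt h'),
          coeff_eq_zero_of_natDegree_lt (hQ.trans_lt h')]
        simp
    have hdQ : Q'.natDegree ≤ d := by
      rw [natDegree_le_iff_coeff_eq_zero]
      intro N hN
      rw [← coeff_X_mul, ← hQ', coeff_add, coeff_C_mul, coeff_C_mul,
        coeff_eq_zero_of_natDegree_lt (hP.trans_lt (by omega)),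
        coeff_eq_zero_of_natDegree_lt (hQ.trans_lt (by omega))]
      simp
    obtain ⟨l, hl, hlPQ⟩ := ih P' Q' hdP hdQ fun z hz => by
      have h1 := h z hz
      have h2 := congrArg (eval z) hQ'
      have h3 : ‖eval z Q'‖ = ‖star w₀ * eval z P + star w₁ * eval z Q‖ := by
        simp only [eval_add, eval_mul, eval_C, eval_X] at h2
        rw [h2, norm_mul, hz, one_mul]
      rw [h3]
      apply Complex.ofReal_injective
      have h1' := congrArg ((↑) : ℝ → ℂ) h1
      simp only [Complex.ofReal_add, ← mul_star_eq_norm_sq, hP', eval_sub,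
        eval_mul, eval_C, star_sub, star_add, star_mul', star_star, Complex.ofReal_one] at h1' ⊢
      rw [← h1']
      linear_combination (eval z P * star (eval z P) + eval z Q * star (eval z Q)) * hw
    -- The unitary that maps `(P', X * Q')` back to `(P, Q)`.
    refine ⟨⟨!![-star w₁, w₀; star w₀, w₁], mem_unitaryGroup_two _ _ _ _ ?_ ?_ ?_⟩ :: l,
      by simp [hl], ?_⟩
    · simp only [star_neg, star_star]; linear_combination hw
    · exact hw
    · simp only [star_neg, star_star]; ring
    · simp only [signalPair, hlPQ, Matrix.of_apply, Matrix.cons_val', Matrix.cons_val_zero,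
        Matrix.cons_val_one, Matrix.cons_val_fin_one, ← hQ']
      ext1
      · simp only [C_neg, hP']; linear_combination P * hwC
      · simp only [hP']; linear_combination Q * hwC

end GroundStatePrep

namespace GroundStatePrep

open Polynomial

/-! ### A low-pass filter -/

/-- The `m`-th power of the normalised geometric sum `(1 + X + ⋯ + X ^ (N - 1)) / N`. -/
noncomputable def kernelPoly (N m : ℕ) : ℂ[X] := (C (N : ℂ)⁻¹ * ∑ k ∈ Finset.range N, X ^ k) ^ m

theorem natDegree_kernelPoly_le (N m : ℕ) : (kernelPoly N m).natDegree ≤ m * (N - 1) := by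
  refine natDegree_pow_le_of_le m ((natDegree_C_mul_le _ _).trans ?_)
  refine natDegree_sum_le_of_forall_le _ _ fun k hk => ?_
  rw [natDegree_X_pow]
  have := Finset.mem_range.1 hk
  omega

theorem eval_kernelPoly (N m : ℕ) (z : ℂ) :
    (kernelPoly N m).eval z = ((N : ℂ)⁻¹ * ∑ k ∈ Finset.range N, z ^ k) ^ m := by
  simp [kernelPoly, eval_finsetSum]

theorem kernelPoly_eval_one {N : ℕ} (hN : N ≠ 0) (m : ℕ) : (kernelPoly N m).eval 1 = 1 := by
  simp [eval_kernelPoly, hN]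

/-- The geometric sum is palindromic, so its phase on the circle is known. This is what makes `|E|²`
a polynomial up to a power of `z`. -/
theorem kernelPoly_eval_sq (N m : ℕ) {z : ℂ} (hz : ‖z‖ = 1) :
    (kernelPoly N m).eval z ^ 2 = z ^ (m * (N - 1)) * (‖(kernelPoly N m).eval z‖ ^ 2 : ℝ) := by
  have hzz : z * star z = 1 := by rw [mul_star_eq_norm_sq, hz]; simp
  have hsum : ∑ k ∈ Finset.range N, z ^ k =
      z ^ (N - 1) * star (∑ k ∈ Finset.range N, z ^ k) := by
    rw [star_sum, Finset.mul_sum, ← Finset.sum_range_reflect]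
    refine Finset.sum_congr rfl fun k hk => ?_
    have hk := Finset.mem_range.1 hk
    rw [star_pow]
    have h1 : N - 1 = (N - 1 - k) + k := by omega
    nth_rw 2 [h1]
    rw [pow_add, mul_assoc, ← mul_pow, hzz, one_pow, mul_one]
  rw [← mul_star_eq_norm_sq, eval_kernelPoly, star_pow, star_mul', pow_mul', ← mul_pow, ← mul_pow,
    ← pow_mul, mul_comm m 2, pow_mul, star_inv₀, star_natCast]
  congr 1
  linear_combination ((N : ℂ)⁻¹ ^ 2 * ∑ k ∈ Finset.range N, z ^ k) * hsum

/-- The geometric sum times `z - 1` is `z ^ N - 1`, of modulus at most `2`. The average is thus at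
most `2 / (N ‖z - 1‖) ≤ 1/2`, and squaring the `m`-th power gives `(1/4) ^ m`. -/
theorem norm_kernelPoly_eval_le {N : ℕ} (m : ℕ) {z : ℂ} (hz : ‖z‖ = 1)
    (h : 4 ≤ N * ‖z - 1‖) : ‖(kernelPoly N m).eval z‖ ^ 2 ≤ (1 / 4) ^ m := by
  have hN : (0 : ℝ) < (N : ℝ) := by
    rcases Nat.eq_zero_or_pos N with rfl | h'
    · norm_num at h
    · exact_mod_cast h'
  have hz1 : 0 < ‖z - 1‖ := by
    by_contra h'
    nlinarith
  have h1 : ‖(N : ℂ)⁻¹ * ∑ k ∈ Finset.range N, z ^ k‖ ≤ 1 / 2 := by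
    have hg := geom_sum_mul z N
    have h2 : ‖∑ k ∈ Finset.range N, z ^ k‖ * ‖z - 1‖ ≤ 2 := by
      rw [← norm_mul, hg]
      refine (norm_sub_le _ _).trans ?_
      rw [norm_pow, hz]; norm_num
    rw [norm_mul, norm_inv, Complex.norm_natCast, inv_mul_le_iff₀ hN]
    by_contra! h3
    nlinarith [norm_nonneg (∑ k ∈ Finset.range N, z ^ k)]
  rw [eval_kernelPoly, norm_pow, ← pow_mul, mul_comm m 2, pow_mul]
  refine pow_le_pow_left₀ (sq_nonneg _) ?_ m
  nlinarith [norm_nonneg ((N : ℂ)⁻¹ * ∑ k ∈ Finset.range N, z ^ k)]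

/-- Parseval's identity for the values of a polynomial at the `M`-th roots of unity, rotated. -/
theorem sum_norm_eval_sq {M : ℕ} {ω : ℂ} (hω : IsPrimitiveRoot ω M) (hM : M ≠ 0) {E : ℂ[X]}
    (hE : E.natDegree < M) {z : ℂ} (hz : ‖z‖ = 1) :
    ∑ s ∈ Finset.range M, ‖E.eval (z * ω ^ s)‖ ^ 2 =
      M * ∑ j ∈ Finset.range M, ‖E.coeff j‖ ^ 2 := by
  have hωn : ‖ω‖ = 1 := hω.norm'_eq_one hM
  have hω0 : ω ≠ 0 := by rintro rfl; simp at hωn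
  have hωs : star ω = ω⁻¹ := by
    refine eq_inv_of_mul_eq_one_right ?_
    rw [mul_star_eq_norm_sq, hωn]; simp
  have hzz : z * star z = 1 := by rw [mul_star_eq_norm_sq, hz]; simp
  apply Complex.ofReal_injective
  push_cast
  have h1 : ∀ s, (‖E.eval (z * ω ^ s)‖ ^ 2 : ℂ) = ∑ j ∈ Finset.range M, ∑ k ∈ Finset.range M,
      E.coeff j * star (E.coeff k) * z ^ j * star z ^ k * (ω ^ j * (ω⁻¹) ^ k) ^ s := by
    intro s
    rw [← Complex.ofReal_pow, ← mul_star_eq_norm_sq, eval_eq_sum_range' hE, star_sum,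
      Finset.sum_mul_sum]
    refine Finset.sum_congr rfl fun j _ => Finset.sum_congr rfl fun k _ => ?_
    simp only [star_mul', star_pow, hωs, mul_pow, ← pow_mul]
    rw [mul_comm s j, mul_comm s k]
    ring
  simp only [h1]
  rw [Finset.sum_comm, Finset.mul_sum]
  refine Finset.sum_congr rfl fun j hj => ?_
  rw [Finset.sum_comm, Finset.sum_eq_single j]
  · have : ω ^ j * ω⁻¹ ^ j = 1 := by rw [← mul_pow, mul_inv_cancel₀ hω0, one_pow]
    simp only [this, one_pow, mul_one, Finset.sum_const, Finset.card_range, nsmul_eq_mul]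
    rw [mul_assoc, ← mul_pow, hzz, one_pow, mul_one, mul_star_eq_norm_sq]
    push_cast; ring
  · intro k hk hkj
    -- Off the diagonal, `w = ω ^ (j - k)` is an `M`-th root of unity other than `1`, because `j ≠
    -- k` are both below `M`; its powers sum to zero.
    rw [← Finset.mul_sum]
    have hj := Finset.mem_range.1 hj
    have hk := Finset.mem_range.1 hk
    set w := ω ^ j * ω⁻¹ ^ k with hw
    have hw1 : w - 1 ≠ 0 := by
      intro h
      have h2 : w * ω ^ k = ω ^ k := by rw [sub_eq_zero.1 h, one_mul]
      rw [hw, mul_assoc, ← mul_pow, inv_mul_cancel₀ hω0, one_pow, mul_one] at h2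
      exact hkj (hω.pow_inj hj hk h2).symm
    have hwM : w ^ M = 1 := by
      rw [hw, mul_pow, ← pow_mul, ← pow_mul, mul_comm j, mul_comm k, pow_mul, pow_mul, inv_pow,
        hω.pow_eq_one]
      simp
    have h3 := geom_sum_mul w M
    rw [hwM, sub_self] at h3
    rw [(mul_eq_zero.1 h3).resolve_right hw1, mul_zero]
  · intro h; exact absurd hj h

/-- The `s`-th of `M` equidistant angles in `[-π / 2, 3 * π / 2)`. -/
noncomputable def gridAngle (M s : ℕ) : ℝ := -Real.pi / 2 + 2 * Real.pi * s / M

/-- The chord is `2 |sin (t / 2)|`, and `sin (Δ / 4)` is bounded below by Jordan's inequality. The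
bound `3π / 2` on `|t|` keeps `t` away from a full turn by at least `π / 2 ≥ Δ / 2`. -/
theorem le_norm_exp_sub_one {Δ t : ℝ} (hΔ0 : 0 < Δ) (hΔ : Δ ≤ Real.pi) (ht : Δ / 2 ≤ |t|)
    (ht' : |t| ≤ 3 * Real.pi / 2) : Δ / Real.pi ≤ ‖Complex.exp (t * Complex.I) - 1‖ := by
  have hpi := Real.pi_pos
  have h1 : ‖Complex.exp (t * Complex.I) - 1‖ = ‖2 * Real.sin (t / 2)‖ := by
    rw [mul_comm]; exact Complex.norm_exp_I_mul_ofReal_sub_one t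
  have h2 : |Real.sin (t / 2)| = Real.sin (|t| / 2) := by
    rcases abs_cases t with ⟨h, _⟩ | ⟨h, _⟩
    · rw [h, abs_of_nonneg (Real.sin_nonneg_of_nonneg_of_le_pi (by linarith) (by linarith))]
    · rw [h, neg_div, Real.sin_neg, abs_of_nonpos]
      have := Real.sin_nonneg_of_nonneg_of_le_pi (x := -(t / 2)) (by linarith) (by linarith)
      rw [Real.sin_neg] at this; linarith
  rw [h1, norm_mul, Real.norm_eq_abs, Real.norm_eq_abs, h2, abs_two]
  have h3 : Real.sin (Δ / 4) ≤ Real.sin (|t| / 2) := by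
    rcases le_total (|t| / 2) (Real.pi / 2) with h | h
    · exact Real.sin_le_sin_of_le_of_le_pi_div_two (by linarith) h (by linarith)
    · rw [← Real.sin_pi_sub (|t| / 2)]
      exact Real.sin_le_sin_of_le_of_le_pi_div_two (by linarith) (by linarith) (by linarith)
  have h4 := Real.mul_le_sin (x := Δ / 4) (by linarith) (by linarith)
  have h5 : Δ / Real.pi = 2 * (2 / Real.pi * (Δ / 4)) := by ring
  rw [h5]; linarith

/-- A discretised step function convolved with a kernel. The translates of `|E|²` to all `M` grid
angles sum to the constant `T`, and `P` keeps those at angles up to `μ`, divided by `2 T`. Below the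
threshold only far translates are missing; above it only far translates are present. All far
translates together weigh at most `δ`. Energies in `[0, π]` and grid angles in `[-π / 2, 3π / 2)`
differ by at most `3π / 2`, so no far translate comes close by going round the circle. -/
theorem exists_lowPass {Δ μ δ : ℝ} {N m : ℕ} (hΔ0 : 0 < Δ) (hΔ : Δ ≤ Real.pi) (hδ0 : 0 < δ)
    (hδ : δ ≤ 1 / 2) (hN : 4 * Real.pi ≤ N * Δ) (hm : N ≤ δ * 2 ^ m) :
    ∃ P : ℂ[X], P.natDegree ≤ 2 * (m * N) ∧ (∀ z : ℂ, ‖z‖ = 1 → ‖P.eval z‖ ≤ 1 / 2) ∧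
      (∀ l : ℝ, 0 ≤ l → l ≤ Real.pi → l ≤ μ - Δ / 2 →
        1 / 4 ≤ ‖P.eval (Complex.exp (-(l * Complex.I)))‖) ∧
      ∀ l : ℝ, 0 ≤ l → l ≤ Real.pi → μ + Δ / 2 ≤ l →
        ‖P.eval (Complex.exp (-(l * Complex.I)))‖ ≤ δ / 2 := by
  have hpi := Real.pi_pos
  have hN0 : N ≠ 0 := by
    rintro rfl
    norm_num at hN; linarith
  have hN1 : (1 : ℝ) ≤ N := by exact_mod_cast Nat.one_le_iff_ne_zero.2 hN0
  have hm0 : m ≠ 0 := by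
    rintro rfl
    norm_num at hm; linarith
  set d := m * (N - 1) with hd
  -- One more point than the degree of `E`, as Parseval requires.
  set M := d + 1 with hMdef
  have hM0 : M ≠ 0 := Nat.succ_ne_zero d
  have hMN : M ≤ m * N := by
    obtain ⟨k, rfl⟩ := Nat.exists_eq_succ_of_ne_zero hN0
    have : 1 ≤ m := Nat.one_le_iff_ne_zero.2 hm0
    rw [hMdef, hd, Nat.succ_sub_one, Nat.mul_succ]; omega
  have hMpos : (0 : ℝ) < M := by positivity
  set E := kernelPoly N m with hE
  have hEd : E.natDegree < M := Nat.lt_succ_of_le (natDegree_kernelPoly_le N m)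
  set T : ℝ := M * ∑ j ∈ Finset.range M, ‖E.coeff j‖ ^ 2 with hT
  have hω := Complex.isPrimitiveRoot_exp M hM0
  set ω : ℂ := Complex.exp (2 * Real.pi * Complex.I / M) with hωdef
  set e : ℕ → ℂ := fun s => Complex.exp (gridAngle M s * Complex.I) with he
  have hen : ∀ s, ‖e s‖ = 1 := fun s => Complex.norm_exp_ofReal_mul_I _
  have hes : ∀ s, e s = e 0 * ω ^ s := by
    intro s
    simp only [he, hωdef, gridAngle]
    rw [← Complex.exp_nat_mul, ← Complex.exp_add]
    congr 1
    push_cast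
    ring
  have hsumT : ∀ z : ℂ, ‖z‖ = 1 → ∑ s ∈ Finset.range M, ‖E.eval (z * e s)‖ ^ 2 = T := by
    intro z hz
    rw [hT, ← sum_norm_eval_sq hω hM0 hEd (z := z * e 0) (by rw [norm_mul, hz, hen, one_mul])]
    refine Finset.sum_congr rfl fun s _ => ?_
    rw [hes s, mul_assoc]
  -- The single term `|E 1|² = 1` already gives the bound.
  have hT1 : 1 ≤ T := by
    rw [hT, ← sum_norm_eval_sq hω hM0 hEd (z := 1) (by simp)]
    refine le_trans (le_of_eq ?_) (Finset.single_le_sum (f := fun s => ‖E.eval (1 * ω ^ s)‖ ^ 2)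
      (fun s _ => by positivity) (Finset.mem_range.2 (Nat.pos_of_ne_zero hM0)))
    simp [hE, kernelPoly_eval_one hN0]
  classical
  set S := (Finset.range M).filter fun s => gridAngle M s ≤ μ with hS
  have hSsub : S ⊆ Finset.range M := Finset.filter_subset _ _
  -- Squaring `E (z e_s)` produces the phase `(z e_s) ^ d`. The factor `(e s)⁻¹ ^ d` removes its
  -- dependence on `s`, so that the summands add without cancellation.
  set P : ℂ[X] := C (((2 * T : ℝ) : ℂ)⁻¹) * ∑ s ∈ S, C ((e s)⁻¹ ^ d) * (E.comp (X * C (e s))) ^ 2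
    with hP
  have hPev : ∀ z : ℂ, ‖z‖ = 1 →
      P.eval z = z ^ d * (((∑ s ∈ S, ‖E.eval (z * e s)‖ ^ 2) / (2 * T) : ℝ) : ℂ) := by
    intro z hz
    simp only [hP, eval_mul, eval_C, eval_finsetSum, eval_pow, eval_comp, eval_X]
    push_cast
    rw [div_eq_inv_mul, mul_left_comm]
    congr 1
    rw [Finset.mul_sum]
    refine Finset.sum_congr rfl fun s _ => ?_
    rw [hE, kernelPoly_eval_sq N m (by rw [norm_mul, hz, hen, one_mul]), ← hd, mul_pow, ← mul_assoc,
      mul_left_comm, ← mul_pow (e s)⁻¹, inv_mul_cancel₀ (by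
        intro h; have := hen s; rw [h] at this; simp at this), one_pow, mul_one]
    push_cast; rfl
  have hPn : ∀ z : ℂ, ‖z‖ = 1 → ‖P.eval z‖ = (∑ s ∈ S, ‖E.eval (z * e s)‖ ^ 2) / (2 * T) := by
    intro z hz
    rw [hPev z hz, norm_mul, norm_pow, hz, one_pow, one_mul, Complex.norm_real, Real.norm_eq_abs,
      abs_of_nonneg]
    exact div_nonneg (Finset.sum_nonneg fun s _ => by positivity) (by linarith)
  have hgrid : ∀ s ∈ Finset.range M,
      -Real.pi / 2 ≤ gridAngle M s ∧ gridAngle M s ≤ 3 * Real.pi / 2 := by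
    intro s hs
    have hs : (s : ℝ) ≤ M := by exact_mod_cast (Finset.mem_range.1 hs).le
    have h1 : 0 ≤ 2 * Real.pi * s / M := by positivity
    have h2 : 2 * Real.pi * s / M ≤ 2 * Real.pi := by
      rw [div_le_iff₀ hMpos]
      exact mul_le_mul_of_nonneg_left hs (by positivity)
    constructor <;> simp only [gridAngle] <;> linarith
  have hzn : ∀ l : ℝ, ‖Complex.exp (-(l * Complex.I))‖ = 1 := fun l => by
    rw [← neg_mul, ← Complex.ofReal_neg]; exact Complex.norm_exp_ofReal_mul_I _
  have hfar : ∀ (l : ℝ) (s : ℕ), Δ / 2 ≤ |gridAngle M s - l| →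
      |gridAngle M s - l| ≤ 3 * Real.pi / 2 →
      ‖E.eval (Complex.exp (-(l * Complex.I)) * e s)‖ ^ 2 ≤ (1 / 4) ^ m := by
    intro l s h1 h2
    have h3 := le_norm_exp_sub_one hΔ0 hΔ h1 h2
    have h4 : Complex.exp (-(l * Complex.I)) * e s =
        Complex.exp (((gridAngle M s - l : ℝ) : ℂ) * Complex.I) := by
      rw [he, ← Complex.exp_add]; congr 1; push_cast; ring
    rw [h4]
    refine norm_kernelPoly_eval_le m (Complex.norm_exp_ofReal_mul_I _) ?_
    refine le_trans ?_ (mul_le_mul_of_nonneg_left h3 (by linarith))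
    rw [← mul_div_assoc, le_div_iff₀ hpi]; exact hN
  have htail : ∀ (l : ℝ) (S' : Finset ℕ), S' ⊆ Finset.range M →
      (∀ s ∈ S', Δ / 2 ≤ |gridAngle M s - l| ∧ |gridAngle M s - l| ≤ 3 * Real.pi / 2) →
      ∑ s ∈ S', ‖E.eval (Complex.exp (-(l * Complex.I)) * e s)‖ ^ 2 ≤ δ := by
    intro l S' hS' h
    calc _ ≤ ∑ s ∈ S', (1 / 4 : ℝ) ^ m :=
          Finset.sum_le_sum fun s hs => hfar l s (h s hs).1 (h s hs).2
      _ = S'.card * (1 / 4 : ℝ) ^ m := by rw [Finset.sum_const, nsmul_eq_mul]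
      -- The crude bound `m ≤ 2 ^ m` on the number of translates costs one factor `2 ^ m`, and `N ≤
      -- δ * 2 ^ m` another; `4 ^ (-m)` absorbs both.
      _ ≤ (2 ^ m * N) * (1 / 4 : ℝ) ^ m := by
          gcongr
          have h1 := Finset.card_le_card hS'
          rw [Finset.card_range] at h1
          have h2 : m ≤ 2 ^ m := Nat.lt_two_pow_self.le
          have : S'.card ≤ 2 ^ m * N := h1.trans (hMN.trans (Nat.mul_le_mul_right N h2))
          exact_mod_cast this
      _ ≤ (2 ^ m * (δ * 2 ^ m)) * (1 / 4 : ℝ) ^ m := by gcongr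
      _ = δ * ((2 * 2 * (1 / 4)) ^ m) := by rw [mul_pow, mul_pow]; ring
      _ = δ := by norm_num
  refine ⟨P, ?_, fun z hz => ?_, fun l hl0 hlpi hl => ?_, fun l hl0 hlpi hl => ?_⟩
  · refine (natDegree_C_mul_le _ _).trans (natDegree_sum_le_of_forall_le _ _ fun s _ => ?_)
    refine (natDegree_C_mul_le _ _).trans (natDegree_pow_le_of_le 2 ?_)
    refine natDegree_comp_le.trans ?_
    have : (X * C (e s)).natDegree ≤ 1 := (natDegree_mul_C_le _ _).trans natDegree_X_le
    calc _ ≤ E.natDegree * 1 := Nat.mul_le_mul_left _ this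
      _ ≤ m * N := by omega
  · rw [hPn z hz, div_le_iff₀ (by linarith)]
    have := Finset.sum_le_sum_of_subset_of_nonneg hSsub
      (f := fun s => ‖E.eval (z * e s)‖ ^ 2) fun s _ _ => by positivity
    rw [hsumT z hz] at this
    linarith
  · rw [hPn _ (hzn l), le_div_iff₀ (by linarith)]
    have h1 := Finset.sum_sdiff hSsub
      (f := fun s => ‖E.eval (Complex.exp (-(l * Complex.I)) * e s)‖ ^ 2)
    rw [hsumT _ (hzn l)] at h1
    have h2 := htail l (Finset.range M \ S) Finset.sdiff_subset fun s hs => by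
      rw [Finset.mem_sdiff] at hs
      have h3 : μ < gridAngle M s := by
        by_contra! h
        exact hs.2 (Finset.mem_filter.2 ⟨hs.1, h⟩)
      have := hgrid s hs.1
      rw [abs_of_pos (by linarith)]
      constructor <;> linarith
    -- The retained weight is at least `T - δ`, and `(T - δ) / (2 T) ≥ 1/4` because `δ ≤ 1/2 ≤ T /
    -- 2`.
    linarith
  · rw [hPn _ (hzn l), div_le_iff₀ (by linarith)]
    have h2 := htail l S hSsub fun s hs => by
      have h3 := (Finset.mem_filter.1 hs).2
      have := hgrid s (hSsub hs)
      rw [abs_of_neg (by linarith)]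
      constructor <;> linarith
    nlinarith

end GroundStatePrep

namespace GroundStatePrep

/-! ### Matrices acting on a register -/

section Register

variable {X R : Type*} [Fintype R]

/-- A register of type `R` that can be read and overwritten in configurations of type `X`. -/
structure Register (X R : Type*) where
  get : X → R
  put : X → R → X
  get_put : ∀ x r, get (put x r) = r
  put_get : ∀ x, put x (get x) = x
  put_put : ∀ x r s, put (put x r) s = put x s

/-- Action of a family of matrices, controlled by the rest of the configuration, on a register. -/
def Register.act (L : Register X R) (A : X → Matrix R R ℂ) (ψ : X → ℂ) : X → ℂ := fun x =>
  ∑ r, A x (L.get x) r * ψ (L.put x r)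

theorem Register.act_act (L : Register X R) {A B : X → Matrix R R ℂ}
    (hB : ∀ x r, B (L.put x r) = B x) (ψ : X → ℂ) :
    L.act A (L.act B ψ) = L.act (fun x => A x * B x) ψ := by
  funext x
  simp only [act, L.get_put, L.put_put, hB, Matrix.mul_apply, Finset.mul_sum, Finset.sum_mul]
  rw [Finset.sum_comm]
  exact Finset.sum_congr rfl fun _ _ => Finset.sum_congr rfl fun _ _ => by ring

theorem Register.act_one [DecidableEq R] (L : Register X R) (ψ : X → ℂ) : L.act (fun _ => 1) ψ = ψ := by
  funext x
  simp [act, Matrix.one_apply, L.put_get]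

variable [Fintype X]

/-- Exchanging the contents of the register with the value to be written is an involution on pairs.
-/
theorem Register.sum_swap (L : Register X R) (F : X → X → ℂ) :
    ∑ x, ∑ r, F x (L.put x r) = ∑ x, ∑ r, F (L.put x r) x := by
  rw [← Fintype.sum_prod_type', ← Fintype.sum_prod_type']
  let e : X × R ≃ X × R :=
    { toFun := fun p => (L.put p.1 p.2, L.get p.1)
      invFun := fun p => (L.put p.1 p.2, L.get p.1)
      left_inv := fun p => by simp [L.get_put, L.put_put, L.put_get]
      right_inv := fun p => by simp [L.get_put, L.put_put, L.put_get] }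
  refine Fintype.sum_equiv e _ _ fun p => ?_
  simp [e, L.put_put, L.put_get]

/-- The common source of adjoints for all gates and queries. The family may depend on the
configuration only outside the register, as a control does. -/
theorem Register.star_dotProduct_act (L : Register X R) {A : X → Matrix R R ℂ}
    (hA : ∀ x r, A (L.put x r) = A x) (φ ψ : X → ℂ) :
    star φ ⬝ᵥ L.act A ψ = star (L.act (fun x => (A x)ᴴ) φ) ⬝ᵥ ψ := by
  have h := L.sum_swap fun x y => star (φ x) * (A x (L.get x) (L.get y) * ψ y)
  simp only [L.get_put, hA] at h
  simp only [dotProduct, act, Pi.star_apply, star_sum, Finset.mul_sum, Finset.sum_mul, h,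
    star_mul', Matrix.conjTranspose_apply, star_star]
  exact Finset.sum_congr rfl fun _ _ => Finset.sum_congr rfl fun _ _ => by ring

end Register

variable {m n : ℕ}

/-- A single wire as a register. -/
def wireRegister (q : Wire m n) : Register (Wire m n → Fin 2) (Fin 2) where
  get x := x q
  put x b := Function.update x q b
  get_put := by simp
  put_get := by simp
  put_put := by simp

/-- An ordered pair of wires as a register. -/
def pairRegister (q r : Wire m n) (h : q ≠ r) :
    Register (Wire m n → Fin 2) (Fin 2 × Fin 2) where
  get x := (x q, x r)
  put x b := Function.update (Function.update x q b.1) r b.2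
  get_put x b := by simp [Function.update_of_ne h]
  put_get := by simp
  put_put x b c := by
    funext i
    by_cases hr : i = r
    · simp [hr]
    · by_cases hq : i = q
      · simp [hq, h]
      · simp [hr, hq]

/-- The system register. -/
def sysRegister (m n : ℕ) : Register (Wire m n → Fin 2) (SysBasis n) where
  get x := fun j => x (Sum.inr j)
  put x y := Sum.elim (fun i => x (Sum.inl i)) y
  get_put _ _ := rfl
  put_get x := by funext i; cases i <;> rfl
  put_put _ _ _ := rfl

theorem applyOne_eq_act (q : Wire m n) (V : Matrix (Fin 2) (Fin 2) ℂ) :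
    applyOne q V = (wireRegister q).act fun _ => V := rfl

theorem applyTwo_eq_act (q r : Wire m n) (h : q ≠ r)
    (V : Matrix (Fin 2 × Fin 2) (Fin 2 × Fin 2) ℂ) :
    applyTwo q r V = (pairRegister q r h).act fun _ => V := by
  funext ψ x
  simp only [applyTwo, Register.act, Fintype.sum_prod_type]
  rfl

theorem applySys_eq_act (A : Matrix (SysBasis n) (SysBasis n) ℂ) :
    applySys (m := m) A = (sysRegister m n).act fun _ => A := rfl

theorem applyCtrlSys_eq_act (a : Fin m) (A : Matrix (SysBasis n) (SysBasis n) ℂ) :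
    applyCtrlSys a A = (sysRegister m n).act fun x => if x (Sum.inl a) = 1 then A else 1 := by
  funext ψ x
  by_cases h : x (Sum.inl a) = 1
  · simp [applyCtrlSys, Register.act, h, applySys_eq_act]
  · simp only [applyCtrlSys, h, if_false]
    exact (congrFun ((sysRegister m n).act_one ψ) x).symm.trans (by simp [Register.act, h])

theorem ctrlFamily_put (a : Fin m) (A : Matrix (SysBasis n) (SysBasis n) ℂ)
    (x : Wire m n → Fin 2) (y : SysBasis n) :
    (if (sysRegister m n).put x y (Sum.inl a) = 1 then A else 1) =
      if x (Sum.inl a) = 1 then A else 1 := rfl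

/-! ### Inverses of operations and of lists of operations -/

/-- The inverse operation. -/
def Op.inverse : Op m n → Op m n
  | .one q V => .one q (star V)
  | .two q r h V => .two q r h (star V)
  | .queryU inv => .queryU (!inv)
  | .queryCtrlU a inv => .queryCtrlU a (!inv)
  | .queryUI inv => .queryUI (!inv)

section Run

variable (U UI : Matrix (SysBasis n) (SysBasis n) ℂ)

/-- Apply the operations of a list from left to right. -/
def runOps (l : List (Op m n)) (ψ : State m n) : State m n :=
  l.foldl (fun φ g => g.apply U UI φ) ψ

@[simp] theorem runOps_nil (ψ : State m n) : runOps U UI [] ψ = ψ := rfl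

@[simp] theorem runOps_cons (g : Op m n) (l : List (Op m n)) (ψ : State m n) :
    runOps U UI (g :: l) ψ = runOps U UI l (g.apply U UI ψ) := rfl

@[simp] theorem runOps_append (l l' : List (Op m n)) (ψ : State m n) :
    runOps U UI (l ++ l') ψ = runOps U UI l' (runOps U UI l ψ) := List.foldl_append

/-- The operations that undo those of a list. -/
def inverseOps (l : List (Op m n)) : List (Op m n) := (l.map Op.inverse).reverse

theorem Register.act_smul_add {X R : Type*} [Fintype R] (L : Register X R)
    (A : X → Matrix R R ℂ) (c : ℂ) (φ ψ : X → ℂ) :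
    L.act A (c • φ + ψ) = c • L.act A φ + L.act A ψ := by
  funext x
  simp only [act, Pi.add_apply, Pi.smul_apply, smul_eq_mul, Finset.mul_sum,
    ← Finset.sum_add_distrib]
  exact Finset.sum_congr rfl fun _ _ => by ring

theorem Op.apply_smul_add (g : Op m n) (c : ℂ) (φ ψ : State m n) :
    g.apply U UI (c • φ + ψ) = c • g.apply U UI φ + g.apply U UI ψ := by
  cases g with
  | one q V => simp only [Op.apply, applyOne_eq_act, Register.act_smul_add]
  | two q r h V => simp only [Op.apply, applyTwo_eq_act q r h, Register.act_smul_add]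
  | queryU inv => simp only [Op.apply, applySys_eq_act, Register.act_smul_add]
  | queryCtrlU a inv => simp only [Op.apply, applyCtrlSys_eq_act, Register.act_smul_add]
  | queryUI inv => simp only [Op.apply, applySys_eq_act, Register.act_smul_add]

theorem runOps_smul_add (l : List (Op m n)) (c : ℂ) (φ ψ : State m n) :
    runOps U UI l (c • φ + ψ) = c • runOps U UI l φ + runOps U UI l ψ := by
  induction l generalizing φ ψ with
  | nil => rfl
  | cons g l ih => rw [runOps_cons, Op.apply_smul_add, ih]; rfl

theorem maybeAdjoint_not (inv : Bool) (A : Matrix (SysBasis n) (SysBasis n) ℂ) :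
    maybeAdjoint (!inv) A = (maybeAdjoint inv A)ᴴ := by
  cases inv <;> simp [maybeAdjoint]

theorem star_dotProduct_apply (g : Op m n) (φ ψ : State m n) :
    star φ ⬝ᵥ g.apply U UI ψ = star (g.inverse.apply U UI φ) ⬝ᵥ ψ := by
  cases g with
  | one q V =>
    simp only [Op.apply, Op.inverse, applyOne_eq_act]
    exact (wireRegister q).star_dotProduct_act (fun _ _ => rfl) φ ψ
  | two q r h V =>
    simp only [Op.apply, Op.inverse, applyTwo_eq_act q r h]
    exact (pairRegister q r h).star_dotProduct_act (fun _ _ => rfl) φ ψ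
  | queryU inv =>
    simp only [Op.apply, Op.inverse, maybeAdjoint_not, applySys_eq_act]
    exact (sysRegister m n).star_dotProduct_act (fun _ _ => rfl) φ ψ
  | queryCtrlU a inv =>
    have hA : (fun x : Wire m n → Fin 2 => if x (Sum.inl a) = 1 then (maybeAdjoint inv U)ᴴ else 1) =
        fun x => (if x (Sum.inl a) = 1 then maybeAdjoint inv U else 1)ᴴ := by
      funext x
      split_ifs <;> simp
    simp only [Op.apply, Op.inverse, maybeAdjoint_not, applyCtrlSys_eq_act, hA]
    exact (sysRegister m n).star_dotProduct_act (ctrlFamily_put a _) φ ψ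
  | queryUI inv =>
    simp only [Op.apply, Op.inverse, maybeAdjoint_not, applySys_eq_act]
    exact (sysRegister m n).star_dotProduct_act (fun _ _ => rfl) φ ψ

theorem star_dotProduct_runOps (l : List (Op m n)) (φ ψ : State m n) :
    star φ ⬝ᵥ runOps U UI l ψ = star (runOps U UI (inverseOps l) φ) ⬝ᵥ ψ := by
  induction l generalizing ψ with
  | nil => rfl
  | cons g l ih =>
    rw [runOps_cons, ih, star_dotProduct_apply]
    simp [inverseOps]

variable {U UI}

theorem maybeAdjoint_mul_not {A : Matrix (SysBasis n) (SysBasis n) ℂ}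
    (hA : A ∈ Matrix.unitaryGroup (SysBasis n) ℂ) (inv : Bool) :
    maybeAdjoint inv A * maybeAdjoint (!inv) A = 1 := by
  cases inv
  · exact Matrix.mem_unitaryGroup_iff.1 hA
  · exact Matrix.mem_unitaryGroup_iff'.1 hA

theorem Op.apply_apply_inverse (hU : U ∈ Matrix.unitaryGroup (SysBasis n) ℂ)
    (hUI : UI ∈ Matrix.unitaryGroup (SysBasis n) ℂ) (g : Op m n) (ψ : State m n) :
    g.apply U UI (g.inverse.apply U UI ψ) = ψ := by
  have one : ∀ {R : Type} [Fintype R] [DecidableEq R] (L : Register (Wire m n → Fin 2) R)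
      (A B : (Wire m n → Fin 2) → Matrix R R ℂ), (∀ x r, B (L.put x r) = B x) →
      (∀ x, A x * B x = 1) → L.act A (L.act B ψ) = ψ := by
    intro R _ _ L A B hB hAB
    rw [L.act_act hB]
    rw [funext hAB]
    exact L.act_one ψ
  cases g with
  | one q V =>
    simp only [Op.apply, Op.inverse, applyOne_eq_act]
    exact one (wireRegister q) _ _ (fun _ _ => rfl) fun _ => Matrix.mem_unitaryGroup_iff.1 V.2
  | two q r h V =>
    simp only [Op.apply, Op.inverse, applyTwo_eq_act q r h]
    exact one (pairRegister q r h) _ _ (fun _ _ => rfl) fun _ => Matrix.mem_unitaryGroup_iff.1 V.2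
  | queryU inv =>
    simp only [Op.apply, Op.inverse, applySys_eq_act]
    exact one (sysRegister m n) _ _ (fun _ _ => rfl) fun _ => maybeAdjoint_mul_not hU inv
  | queryCtrlU a inv =>
    simp only [Op.apply, Op.inverse, applyCtrlSys_eq_act]
    refine one (sysRegister m n) _ _ (ctrlFamily_put a _) fun x => ?_
    split_ifs
    · exact maybeAdjoint_mul_not hU inv
    · exact one_mul 1
  | queryUI inv =>
    simp only [Op.apply, Op.inverse, applySys_eq_act]
    exact one (sysRegister m n) _ _ (fun _ _ => rfl) fun _ => maybeAdjoint_mul_not hUI inv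

theorem runOps_runOps_inverseOps (hU : U ∈ Matrix.unitaryGroup (SysBasis n) ℂ)
    (hUI : UI ∈ Matrix.unitaryGroup (SysBasis n) ℂ) (l : List (Op m n)) (ψ : State m n) :
    runOps U UI l (runOps U UI (inverseOps l) ψ) = ψ := by
  induction l with
  | nil => rfl
  | cons g l ih =>
    have : inverseOps (g :: l) = inverseOps l ++ [g.inverse] := by simp [inverseOps]
    rw [this, runOps_append, runOps_cons, runOps_cons, runOps_nil,
      Op.apply_apply_inverse hU hUI, ih]

theorem Op.inverse_inverse (g : Op m n) : g.inverse.inverse = g := by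
  cases g <;> simp [Op.inverse]

theorem inverseOps_inverseOps (l : List (Op m n)) : inverseOps (inverseOps l) = l := by
  simp [inverseOps, Function.comp_def, Op.inverse_inverse]

theorem star_runOps_dotProduct_runOps (hU : U ∈ Matrix.unitaryGroup (SysBasis n) ℂ)
    (hUI : UI ∈ Matrix.unitaryGroup (SysBasis n) ℂ) (l : List (Op m n)) (φ ψ : State m n) :
    star (runOps U UI l φ) ⬝ᵥ runOps U UI l ψ = star φ ⬝ᵥ ψ := by
  have h := star_dotProduct_runOps U UI (inverseOps l) φ (runOps U UI l ψ)
  rw [inverseOps_inverseOps] at h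
  have h' := runOps_runOps_inverseOps hU hUI (inverseOps l) ψ
  rw [inverseOps_inverseOps] at h'
  rw [← h, h']

end Run

/-! ### Cost of a list of operations -/

/-- Total cost of a list of operations. -/
def opsCost (c : Op m n → ℕ) (l : List (Op m n)) : ℕ := (l.map c).sum

@[simp] theorem opsCost_nil (c : Op m n → ℕ) : opsCost c [] = 0 := rfl

@[simp] theorem opsCost_cons (c : Op m n → ℕ) (g : Op m n) (l : List (Op m n)) :
    opsCost c (g :: l) = c g + opsCost c l := by simp [opsCost]

@[simp] theorem opsCost_append (c : Op m n → ℕ) (l l' : List (Op m n)) :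
    opsCost c (l ++ l') = opsCost c l + opsCost c l' := by simp [opsCost]

theorem opsCost_inverseOps {c : Op m n → ℕ} (hc : ∀ g, c g.inverse = c g) (l : List (Op m n)) :
    opsCost c (inverseOps l) = opsCost c l := by
  induction l with
  | nil => rfl
  | cons g l ih =>
    have : inverseOps (g :: l) = inverseOps l ++ [g.inverse] := by simp [inverseOps]
    rw [this, opsCost_append, ih]
    simp [hc, add_comm]

theorem Op.uCost_inverse (g : Op m n) : g.inverse.uCost = g.uCost := by cases g <;> rfl

theorem Op.uiCost_inverse (g : Op m n) : g.inverse.uiCost = g.uiCost := by cases g <;> rfl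

theorem Op.gateCost_inverse (g : Op m n) : g.inverse.gateCost = g.gateCost := by cases g <;> rfl

/-- A program that runs a list of operations first. -/
def Program.afterOps (l : List (Op m n)) (P : Program m n) : Program m n := l.foldr Program.op P

theorem Program.cost_afterOps (c : Op m n → ℕ) (cM cR : ℕ) (l : List (Op m n))
    (P : Program m n) : (Program.afterOps l P).cost c cM cR = opsCost c l + P.cost c cM cR := by
  induction l with
  | nil => simp [afterOps]
  | cons g l ih =>
    rw [opsCost_cons, add_assoc, ← ih]; rfl

theorem Program.successProb_afterOps (U UI : Matrix (SysBasis n) (SysBasis n) ℂ)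
    (l : List (Op m n)) (P : Program m n) (ψ : State m n) :
    (Program.afterOps l P).successProb U UI ψ = P.successProb U UI (runOps U UI l ψ) := by
  induction l generalizing ψ with
  | nil => rfl
  | cons g l ih => rw [runOps_cons, ← ih]; rfl

theorem Program.successImplies_afterOps (U UI : Matrix (SysBasis n) (SysBasis n) ℂ)
    (Good : State m n → Prop) (l : List (Op m n)) (P : Program m n) (ψ : State m n) :
    (Program.afterOps l P).SuccessImplies U UI Good ψ ↔
      P.SuccessImplies U UI Good (runOps U UI l ψ) := by
  induction l generalizing ψ with
  | nil => rfl
  | cons g l ih => rw [runOps_cons, ← ih]; rfl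

theorem Program.uDepthFrom_le (P : Program m n) (k : ℕ) :
    P.uDepthFrom k ≤ k + P.cost Op.uCost 0 0 := by
  induction P generalizing k with
  | halt => simp [uDepthFrom]
  | op g P ih =>
    refine (ih _).trans ?_
    simp only [cost]; omega
  | measure q P ih =>
    have h0 := ih 0 k
    have h1 := ih 1 k
    simp only [uDepthFrom, cost]; omega
  | restart P ih =>
    have h := ih 0
    simp only [uDepthFrom, cost]; omega

theorem Program.uDepth_le_uQueries (P : Program m n) : P.uDepth ≤ P.uQueries := by
  simpa [uDepth, uQueries] using P.uDepthFrom_le 0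

end GroundStatePrep

namespace GroundStatePrep

noncomputable section

/-! ### Elementary gates -/

/-- The block-diagonal unitary that applies `W b` to the second qubit if the first is `b`. -/
def multiplexer (W : Fin 2 → Matrix.unitaryGroup (Fin 2) ℂ) :
    Matrix.unitaryGroup (Fin 2 × Fin 2) ℂ :=
  ⟨Matrix.of fun r s => if r.1 = s.1 then (W r.1).1 r.2 s.2 else 0, by
    rw [Matrix.mem_unitaryGroup_iff']
    ext ⟨i, j⟩ ⟨k, l⟩
    simp only [Matrix.mul_apply, Matrix.star_apply, Fintype.sum_prod_type, Matrix.one_apply,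
      Matrix.of_apply,
      Prod.mk.injEq]
    by_cases h : i = k
    · subst h
      have h2 := congrFun (congrFun (Matrix.mem_unitaryGroup_iff'.1 (W i).2) j) l
      simp only [Matrix.mul_apply, Matrix.star_apply, Matrix.one_apply] at h2
      rw [Finset.sum_eq_single i]
      · simpa using h2
      · intro b _ hb; simp [hb]
      · simp
    · simp only [h, false_and, if_false]
      refine Finset.sum_eq_zero fun p _ => Finset.sum_eq_zero fun q _ => ?_
      by_cases hp : p = i
      · have : p ≠ k := fun h' => h (hp.symm.trans h')
        simp [this]
      · simp [hp]⟩

variable {m n : ℕ}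

/-- The gate that applies `W b` to the wire `t` if the wire `c` has the value `b`. -/
def ctrlGate (c t : Wire m n) (W : Fin 2 → Matrix.unitaryGroup (Fin 2) ℂ) : Op m n :=
  -- The case `c = t` is a dummy identity gate, so that circuits can be written without carrying
  -- disequalities; it still counts as one gate.
  if h : c ≠ t then .two c t h (multiplexer W) else .one t 1

section Apply

variable (U UI : Matrix (SysBasis n) (SysBasis n) ℂ)

theorem ctrlGate_apply {c t : Wire m n} (h : c ≠ t) (W : Fin 2 → Matrix.unitaryGroup (Fin 2) ℂ) :
    (ctrlGate c t W).apply U UI = (wireRegister t).act fun x => (W (x c)).1 := by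
  funext ψ x
  simp only [ctrlGate, dif_pos h, Op.apply, applyTwo, multiplexer, Register.act, wireRegister,
    Matrix.of_apply]
  rw [Finset.sum_eq_single (x c)]
  · simp
  · intro b _ hb
    simp [hb.symm]
  · simp

end Apply

/-- The Pauli matrix `X`. -/
def pauliX : Matrix.unitaryGroup (Fin 2) ℂ :=
  ⟨!![0, 1; 1, 0], mem_unitaryGroup_two _ _ _ _ (by simp) (by simp) (by simp)⟩

/-- A square root of the Pauli matrix `X`. -/
def sqrtX : Matrix.unitaryGroup (Fin 2) ℂ :=
  ⟨!![(1 + Complex.I) / 2, (1 - Complex.I) / 2; (1 - Complex.I) / 2, (1 + Complex.I) / 2], by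
    have h2 : star (2 : ℂ) = 2 := Complex.conj_ofNat 2
    have hI : star Complex.I = -Complex.I := Complex.conj_I
    refine mem_unitaryGroup_two _ _ _ _ ?_ ?_ ?_ <;>
      simp only [star_div₀, star_add, star_sub, star_one, h2, hI]
    · linear_combination (- 1 / 2) * Complex.I_mul_I
    · linear_combination (- 1 / 2) * Complex.I_mul_I
    · linear_combination (1 / 2) * Complex.I_mul_I⟩

/-- The Hadamard matrix. -/
def hadamard : Matrix.unitaryGroup (Fin 2) ℂ :=
  ⟨!![(√2 : ℂ)⁻¹, (√2 : ℂ)⁻¹; (√2 : ℂ)⁻¹, -(√2 : ℂ)⁻¹], by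
    have h2 : ((√2 : ℝ) : ℂ)⁻¹ * ((√2 : ℝ) : ℂ)⁻¹ = 1 / 2 := by
      rw [← mul_inv, ← Complex.ofReal_mul, Real.mul_self_sqrt (by norm_num)]; norm_num
    have h3 : star ((√2 : ℝ) : ℂ)⁻¹ = ((√2 : ℝ) : ℂ)⁻¹ := by
      rw [star_inv₀, Complex.star_def, Complex.conj_ofReal]
    refine mem_unitaryGroup_two _ _ _ _ ?_ ?_ ?_ <;> simp only [star_neg, h3]
    · linear_combination 2 * h2
    · linear_combination 2 * h2
    · ring⟩

/-- The power `X ^ e`. -/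
def xPow (e : Fin 2) : Matrix (Fin 2) (Fin 2) ℂ := if e = 0 then 1 else pauliX.1

/-- The sign `(-1) ^ e`. -/
def parity (e : Fin 2) : ℂ := if e = 0 then 1 else -1

theorem sqrtX_mul_sqrtX : sqrtX.1 * sqrtX.1 = pauliX.1 := by
  simp only [sqrtX, pauliX]
  ext i j
  fin_cases i <;> fin_cases j <;> simp [Matrix.mul_apply, Fin.sum_univ_two] <;>
    ring_nf <;> simp <;> norm_num

theorem hadamard_mul_xPow_mul_hadamard (e : Fin 2) :
    hadamard.1 * xPow e * hadamard.1 = !![1, 0; 0, parity e] := by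
  have h2 : ((√2 : ℝ) : ℂ)⁻¹ * ((√2 : ℝ) : ℂ)⁻¹ = 1 / 2 := by
    rw [← mul_inv, ← Complex.ofReal_mul, Real.mul_self_sqrt (by norm_num)]; norm_num
  fin_cases e <;> simp only [xPow, parity, pauliX, hadamard] <;> ext i j <;>
    fin_cases i <;> fin_cases j <;>
    simp [Matrix.mul_apply, Fin.sum_univ_two, h2] <;> ring

/-- Add the bit `e x` to the wire `t`. -/
def addBit (t : Wire m n) (e : (Wire m n → Fin 2) → Fin 2) (x : Wire m n → Fin 2) :
    Wire m n → Fin 2 := Function.update x t (x t + e x)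

theorem act_xPow (t : Wire m n) (e : (Wire m n → Fin 2) → Fin 2) (ψ : State m n) :
    (wireRegister t).act (fun x => xPow (e x)) ψ = ψ ∘ addBit t e := by
  funext x
  simp only [Register.act, wireRegister, Fin.sum_univ_two, Function.comp, addBit]
  have two : ∀ a : Fin 2, a = 0 ∨ a = 1 := by decide
  rcases two (e x) with h | h <;> rcases two (x t) with h' | h' <;>
    simp [h, h', xPow, pauliX, Matrix.one_apply]

theorem act_diag_parity (t : Wire m n) (e : (Wire m n → Fin 2) → Fin 2) (ψ : State m n) :
    (wireRegister t).act (fun x => !![1, 0; 0, parity (e x)]) ψ =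
      fun x => parity (e x * x t) * ψ x := by
  funext x
  have two : ∀ a : Fin 2, a = 0 ∨ a = 1 := by decide
  simp only [Register.act, wireRegister, Fin.sum_univ_two]
  rcases two (x t) with h' | h'
  · have : Function.update x t 0 = x := by rw [← h', Function.update_eq_self]
    simp [h', this, parity]
  · have : Function.update x t 1 = x := by rw [← h', Function.update_eq_self]
    simp [h', this]

theorem addBit_addBit {t : Wire m n} {e : (Wire m n → Fin 2) → Fin 2}
    (he : ∀ x v, e (Function.update x t v) = e x) (x : Wire m n → Fin 2) :
    addBit t e (addBit t e x) = x := by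
  simp only [addBit, he, Function.update_self, Function.update_idem]
  have : ∀ a b : Fin 2, a + b + b = a := by decide
  rw [this, Function.update_eq_self]

/-! ### Toffoli gates -/

/-- Flip `t` if `c` is `0`. -/
def negCtrlNot (c t : Wire m n) : Op m n := ctrlGate c t fun b => if b = 0 then pauliX else 1

/-- Flip `t` if `c` is `0` and `a` is `1`. -/
def toffoli (c a t : Wire m n) : List (Op m n) :=
  [ctrlGate a t fun b => if b = 0 then 1 else sqrtX,
    negCtrlNot c a,
    ctrlGate a t fun b => if b = 0 then 1 else star sqrtX,
    negCtrlNot c a,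
    ctrlGate c t fun b => if b = 0 then sqrtX else 1]

section Run

variable (U UI : Matrix (SysBasis n) (SysBasis n) ℂ)

theorem negCtrlNot_apply {c t : Wire m n} (h : c ≠ t) (ψ : State m n) :
    (negCtrlNot c t).apply U UI ψ = ψ ∘ addBit t fun x => x c + 1 := by
  rw [negCtrlNot, ctrlGate_apply U UI h, ← act_xPow]
  congr 1
  funext x
  have two : ∀ a : Fin 2, a = 0 ∨ a = 1 := by decide
  rcases two (x c) with h' | h' <;> simp [h', xPow]

/-- With `c' = c + 1`, the exponents of `√X` add up to `a - (a ⊕ c') + c' = 2 a c'`, that is, to `X`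
raised to `a c'`. -/
theorem toffoli_matrix (c a : Fin 2) :
    (if c = 0 then sqrtX else 1 : Matrix.unitaryGroup (Fin 2) ℂ).1 *
      ((if a + (c + 1) = 0 then 1 else star sqrtX : Matrix.unitaryGroup (Fin 2) ℂ).1 *
        (if a = 0 then 1 else sqrtX : Matrix.unitaryGroup (Fin 2) ℂ).1) = xPow ((c + 1) * a) := by
  have two : ∀ a : Fin 2, a = 0 ∨ a = 1 := by decide
  rcases two c with rfl | rfl <;> rcases two a with rfl | rfl
  · simp [xPow]
  · simp [xPow, sqrtX_mul_sqrtX]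
  · simp [xPow]
  · simp [xPow]

theorem runOps_toffoli {c a t : Wire m n} (hca : c ≠ a) (hct : c ≠ t) (hat : a ≠ t)
    (ψ : State m n) :
    runOps U UI (toffoli c a t) ψ = ψ ∘ addBit t fun x => (x c + 1) * x a := by
  simp only [toffoli, runOps_cons, runOps_nil, negCtrlNot_apply U UI hca,
    ctrlGate_apply U UI hat, ctrlGate_apply U UI hct]
  -- Conjugating a gate on `t` by flips of `a` only changes the value that its control sees.
  have conj : ∀ (A : (Wire m n → Fin 2) → Matrix (Fin 2) (Fin 2) ℂ) (φ : State m n),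
      (wireRegister t).act A (φ ∘ addBit a fun x => x c + 1) ∘ (addBit a fun x => x c + 1) =
        (wireRegister t).act (A ∘ addBit a fun x => x c + 1) φ := by
    intro A φ
    funext x
    simp only [Function.comp, Register.act, wireRegister]
    refine Finset.sum_congr rfl fun r _ => ?_
    have h1 : addBit a (fun x => x c + 1) x t = x t := by
      rw [addBit, Function.update_of_ne hat.symm]
    have h2 : addBit a (fun x => x c + 1) (Function.update (addBit a (fun x => x c + 1) x) t r) =
        Function.update x t r := by
      have h3 : Function.update (addBit a (fun x => x c + 1) x) t r =
          addBit a (fun x => x c + 1) (Function.update x t r) := by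
        simp only [addBit, Function.update_of_ne hat, Function.update_of_ne hct]
        rw [Function.update_comm hat]
      rw [h3]
      exact addBit_addBit (fun y v => by rw [Function.update_of_ne hca]) _
    rw [h1, h2]
  rw [conj, Register.act_act, Register.act_act, ← act_xPow]
  · congr 1
    funext x
    rw [← toffoli_matrix]
    simp [addBit, mul_assoc]
  · intro x r
    simp only [wireRegister, Function.update_of_ne hat]
  · intro x r
    simp only [wireRegister, Function.comp_apply, addBit, Function.update_of_ne hat,
      Function.update_of_ne hct, Function.update_self]

/-! ### Multiply controlled gates with borrowed qubits -/

/-- Whether all controls in a list of pairs (control, target) are `0`. -/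
def allZero (L : List (Wire m n × Wire m n)) (x : Wire m n → Fin 2) : Fin 2 :=
  (L.map fun p => x p.1 + 1).prod

/-- A cascade of Toffoli gates that adds to the target of every pair in the list the indicator that
the controls of this pair and of all later pairs are `0`. -/
def ladder : List (Wire m n × Wire m n) → List (Op m n)
  | [] => []
  | [p] => [negCtrlNot p.1 p.2]
  | p :: q :: l => toffoli p.1 q.2 p.2 ++ (ladder (q :: l) ++ toffoli p.1 q.2 p.2)

/-- Action of `ladder` on the computational basis. -/
def ladderMap : List (Wire m n × Wire m n) → (Wire m n → Fin 2) → Wire m n → Fin 2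
  | [], x => x
  | p :: l, x => Function.update (ladderMap l x) p.2 (x p.2 + allZero (p :: l) x)

/-- The targets are distinct and none of them is a control. -/
def LadderWires (L : List (Wire m n × Wire m n)) : Prop :=
  (L.map Prod.snd).Nodup ∧ ∀ p ∈ L, ∀ q ∈ L, p.1 ≠ q.2

theorem LadderWires.tail {p : Wire m n × Wire m n} {L : List (Wire m n × Wire m n)}
    (h : LadderWires (p :: L)) : LadderWires L :=
  ⟨(List.nodup_cons.1 h.1).2, fun q hq r hr =>
    h.2 q (List.mem_cons_of_mem _ hq) r (List.mem_cons_of_mem _ hr)⟩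

theorem allZero_congr {L : List (Wire m n × Wire m n)} {x y : Wire m n → Fin 2}
    (h : ∀ p ∈ L, x p.1 = y p.1) : allZero L x = allZero L y := by
  rw [allZero, allZero]
  congr 1
  exact List.map_congr_left fun p hp => by rw [h p hp]

theorem ladderMap_of_notMem {L : List (Wire m n × Wire m n)} {w : Wire m n}
    (h : w ∉ L.map Prod.snd) (x : Wire m n → Fin 2) : ladderMap L x w = x w := by
  induction L with
  | nil => rfl
  | cons p l ih =>
    simp only [List.map_cons, List.mem_cons, not_or] at h
    rw [ladderMap, Function.update_of_ne h.1, ih h.2]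

theorem ladderMap_update {L : List (Wire m n × Wire m n)} {w : Wire m n}
    (h : w ∉ L.map Prod.snd) (h' : w ∉ L.map Prod.fst) (x : Wire m n → Fin 2) (v : Fin 2) :
    ladderMap L (Function.update x w v) = Function.update (ladderMap L x) w v := by
  induction L with
  | nil => rfl
  | cons p l ih =>
    have hz : allZero (p :: l) (Function.update x w v) = allZero (p :: l) x :=
      allZero_congr fun q hq => by
        rw [Function.update_of_ne]
        rintro rfl
        exact h' (List.mem_map_of_mem hq)
    simp only [List.map_cons, List.mem_cons, not_or] at h h'
    rw [ladderMap, ladderMap, ih h.2 h'.2, Function.update_of_ne (Ne.symm h.1),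
      Function.update_comm h.1, hz]

theorem LadderWires.notMem_snd {p : Wire m n × Wire m n} {L : List (Wire m n × Wire m n)}
    (h : LadderWires (p :: L)) : p.2 ∉ L.map Prod.snd := (List.nodup_cons.1 h.1).1

theorem LadderWires.notMem_fst {p : Wire m n × Wire m n} {L : List (Wire m n × Wire m n)}
    (h : LadderWires (p :: L)) : p.2 ∉ L.map Prod.fst := by
  intro h'
  obtain ⟨q, hq, hqp⟩ := List.mem_map.1 h'
  exact h.2 q (List.mem_cons_of_mem _ hq) p List.mem_cons_self hqp

theorem LadderWires.fst_notMem {L : List (Wire m n × Wire m n)}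
    (h : LadderWires L) {p : Wire m n × Wire m n} (hp : p ∈ L) : p.1 ∉ L.map Prod.snd := by
  intro h'
  obtain ⟨q, hq, hqp⟩ := List.mem_map.1 h'
  exact h.2 p hp q hq hqp.symm

theorem LadderWires.allZero_ladderMap {p : Wire m n × Wire m n} {L : List (Wire m n × Wire m n)}
    (h : LadderWires (p :: L)) (x : Wire m n → Fin 2) :
    allZero (p :: L) (ladderMap L x) = allZero (p :: L) x :=
  allZero_congr fun q hq => ladderMap_of_notMem (fun h' => h.fst_notMem hq (by
    rw [List.map_cons]; exact List.mem_cons_of_mem _ h')) x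

theorem LadderWires.ladderMap_ladderMap {L : List (Wire m n × Wire m n)} (h : LadderWires L)
    (x : Wire m n → Fin 2) : ladderMap L (ladderMap L x) = x := by
  induction L with
  | nil => rfl
  | cons p l ih =>
    have hz : allZero (p :: l) (Function.update (ladderMap l x) p.2
        (x p.2 + allZero (p :: l) x)) = allZero (p :: l) x := by
      rw [← h.allZero_ladderMap x]
      exact allZero_congr fun q hq => by
        rw [Function.update_of_ne (h.2 q hq p List.mem_cons_self)]
    have : ∀ a b : Fin 2, a + b + b = a := by decide
    rw [ladderMap, ladderMap, hz, Function.update_self, ladderMap_update h.notMem_snd h.notMem_fst,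
      ih h.tail, Function.update_idem, this, Function.update_eq_self]

/-- The two outer Toffoli gates read the target of the next pair before and after the inner ladder.
Its unknown initial value is added twice and cancels, leaving the change, which is the indicator for
the later controls. -/
theorem runOps_ladder {L : List (Wire m n × Wire m n)} (h : LadderWires L) (ψ : State m n) :
    runOps U UI (ladder L) ψ = ψ ∘ ladderMap L := by
  induction L generalizing ψ with
  | nil => rfl
  | cons p l ih =>
    cases l with
    | nil =>
      rw [ladder, runOps_cons, runOps_nil, negCtrlNot_apply U UI (h.2 p (by simp) p (by simp))]
      congr 1
      funext x
      simp [addBit, ladderMap, allZero]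
    | cons q l =>
      have hpq : p.1 ≠ q.2 := h.2 p (by simp) q (by simp)
      have hpp : p.1 ≠ p.2 := h.2 p (by simp) p (by simp)
      have hqp : q.2 ≠ p.2 := fun h' => h.notMem_snd (by simp [h'])
      rw [ladder, runOps_append, runOps_append, runOps_toffoli U UI hpq hpp hqp, ih h.tail,
        runOps_toffoli U UI hpq hpp hqp]
      funext x
      simp only [Function.comp]
      congr 1
      have h1 : ladderMap (q :: l) (addBit p.2 (fun x => (x p.1 + 1) * x q.2) x) =
          Function.update (ladderMap (q :: l) x) p.2 (x p.2 + (x p.1 + 1) * x q.2) :=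
        ladderMap_update h.notMem_snd h.notMem_fst _ _
      have h2 : ladderMap (q :: l) x p.1 = x p.1 := ladderMap_of_notMem (fun h' =>
        h.fst_notMem (p := p) (by simp) (by rw [List.map_cons]; exact List.mem_cons_of_mem _ h')) x
      have h3 : ladderMap (q :: l) x q.2 = x q.2 + allZero (q :: l) x := by
        rw [ladderMap, Function.update_self]
      have h4 : allZero (p :: q :: l) x = (x p.1 + 1) * allZero (q :: l) x := by
        simp [allZero]
      rw [h1, addBit, Function.update_self, Function.update_of_ne hpp, Function.update_of_ne hqp,
        Function.update_idem, h2, h3]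
      change _ = Function.update (ladderMap (q :: l) x) p.2 (x p.2 + allZero (p :: q :: l) x)
      rw [h4]
      congr 1
      -- What remains is an identity over four bits.
      generalize allZero (q :: l) x = z
      generalize x p.1 = a
      generalize x p.2 = b
      generalize x q.2 = c
      revert a b c z
      decide

/-- Flip the first target if all controls are `0`. The other targets are borrowed: they may hold
anything and are restored. -/
def multiCtrlNot (L : List (Wire m n × Wire m n)) : List (Op m n) := ladder L ++ ladder L.tail

/-- The ladder of the tail is an involution that undoes everything except the change of the first
target. -/
theorem runOps_multiCtrlNot {p : Wire m n × Wire m n} {L : List (Wire m n × Wire m n)}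
    (h : LadderWires (p :: L)) (ψ : State m n) :
    runOps U UI (multiCtrlNot (p :: L)) ψ = ψ ∘ addBit p.2 (allZero (p :: L)) := by
  rw [multiCtrlNot, List.tail_cons, runOps_append, runOps_ladder U UI h,
    runOps_ladder U UI h.tail]
  funext x
  simp only [Function.comp]
  congr 1
  rw [ladderMap, h.tail.ladderMap_ladderMap, ladderMap_of_notMem h.notMem_snd,
    h.allZero_ladderMap, addBit]

/-- Multiply by `-1` if all controls are `0` and the first target `t` is `1`. -/
def multiCtrlZ (t : Wire m n) (L : List (Wire m n × Wire m n)) : List (Op m n) :=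
  .one t hadamard :: (multiCtrlNot L ++ [.one t hadamard])

theorem LadderWires.allZero_update {p : Wire m n × Wire m n} {L : List (Wire m n × Wire m n)}
    (h : LadderWires (p :: L)) (x : Wire m n → Fin 2) (v : Fin 2) :
    allZero (p :: L) (Function.update x p.2 v) = allZero (p :: L) x :=
  allZero_congr fun q hq => by rw [Function.update_of_ne (h.2 q hq p List.mem_cons_self)]

theorem runOps_multiCtrlZ {p : Wire m n × Wire m n} {L : List (Wire m n × Wire m n)}
    (h : LadderWires (p :: L)) (ψ : State m n) :
    runOps U UI (multiCtrlZ p.2 (p :: L)) ψ =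
      fun x => parity (allZero (p :: L) x * x p.2) * ψ x := by
  rw [multiCtrlZ, runOps_cons, runOps_append, runOps_multiCtrlNot U UI h, runOps_cons, runOps_nil,
    ← act_xPow, ← act_diag_parity]
  simp only [Op.apply, applyOne_eq_act]
  rw [Register.act_act, Register.act_act _ (fun _ _ => rfl)]
  · congr 1
    funext x
    rw [hadamard_mul_xPow_mul_hadamard]
  · intro x r
    have h1 : allZero (p :: L) ((wireRegister p.2).put x r) = allZero (p :: L) x :=
      h.allZero_update x r
    rw [h1]

/-- Multiply by `-1` if the controls of both lists are `0`. The target `t` of the first pairs is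
borrowed. -/
def reflectZero (t : Wire m n) (L L' : List (Wire m n × Wire m n)) : List (Op m n) :=
  multiCtrlNot L ++ (multiCtrlZ t L' ++ (multiCtrlNot L ++ multiCtrlZ t L'))

/-- With `a`, `b` the indicators of the two lists and `c` the borrowed bit, the two phases are `(-1)
^ (b (c + a))` and `(-1) ^ (b c)`. Their product `(-1) ^ (a b)` is free of `c`. -/
theorem runOps_reflectZero {p p' : Wire m n × Wire m n} {L L' : List (Wire m n × Wire m n)}
    (h : LadderWires (p :: L)) (h' : LadderWires (p' :: L')) (hp : p.2 = p'.2) (ψ : State m n) :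
    runOps U UI (reflectZero p.2 (p :: L) (p' :: L')) ψ =
      fun x => parity (allZero (p :: L) x * allZero (p' :: L') x) * ψ x := by
  rw [reflectZero, runOps_append, runOps_append, runOps_append, runOps_multiCtrlNot U UI h, hp,
    runOps_multiCtrlZ U UI h', runOps_multiCtrlNot U UI h, runOps_multiCtrlZ U UI h', ← hp]
  funext x
  simp only [Function.comp, addBit_addBit h.allZero_update]
  have h1 : allZero (p' :: L') (addBit p.2 (allZero (p :: L)) x) = allZero (p' :: L') x := by
    rw [addBit, hp]; exact h'.allZero_update _ _
  rw [h1, addBit, Function.update_self, ← mul_assoc]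
  congr 1
  generalize allZero (p :: L) x = a
  generalize allZero (p' :: L') x = b
  generalize x p.2 = c
  have two : ∀ a : Fin 2, a = 0 ∨ a = 1 := by decide
  rcases two a with rfl | rfl <;> rcases two b with rfl | rfl <;> rcases two c with rfl | rfl <;>
    simp [parity]

end Run

/-! ### The reflection about the zero state -/

theorem prod_eq_zero_of_mem {l : List (Fin 2)} (h : 0 ∈ l) : l.prod = 0 := by
  induction l with
  | nil => simp at h
  | cons a l ih =>
    rw [List.prod_cons]
    rcases List.mem_cons.1 h with rfl | h
    · exact (by decide : ∀ b : Fin 2, 0 * b = 0) _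
    · rw [ih h]
      exact (by decide : ∀ b : Fin 2, b * 0 = 0) _

/-- All wires except the second ancilla. -/
def mainWires (n : ℕ) : List (Wire 2 n) := Sum.inl 0 :: (List.finRange n).map Sum.inr

/-- Pairs of a control in the first list and a target in the second, headed by the second
ancilla. -/
def controlPairs (A B : List (Wire 2 n)) : List (Wire 2 n × Wire 2 n) := A.zip (Sum.inl 1 :: B)

theorem ladderWires_controlPairs {A B : List (Wire 2 n)} (hB : B.Nodup) (hA1 : Sum.inl 1 ∉ A)
    (hB1 : Sum.inl 1 ∉ B) (hAB : A.Disjoint B) : LadderWires (controlPairs A B) := by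
  constructor
  · have : ∀ (l l' : List (Wire 2 n)), l'.Nodup → ((l.zip l').map Prod.snd).Nodup := by
      intro l
      induction l with
      | nil => simp
      | cons a l ih =>
        intro l' hl'
        cases l' with
        | nil => simp
        | cons b l' =>
          have hl' := List.nodup_cons.1 hl'
          simp only [List.zip_cons_cons, List.map_cons]
          refine List.nodup_cons.2 ⟨fun h => hl'.1 ?_, ih l' hl'.2⟩
          obtain ⟨p, hp, rfl⟩ := List.mem_map.1 h
          exact (List.of_mem_zip (a := p.1) (b := p.2) hp).2
    exact this _ _ (List.nodup_cons.2 ⟨hB1, hB⟩)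
  · intro p hp q hq
    have h1 := (List.of_mem_zip (a := p.1) (b := p.2) hp).1
    have h2 := (List.of_mem_zip (a := q.1) (b := q.2) hq).2
    rcases List.mem_cons.1 h2 with h2 | h2
    · rw [h2]; rintro h3; exact hA1 (h3 ▸ h1)
    · intro h3; exact hAB h1 (h3 ▸ h2)

theorem allZero_controlPairs {A B : List (Wire 2 n)} (h : A.length ≤ B.length + 1)
    (x : Wire 2 n → Fin 2) :
    allZero (controlPairs A B) x = (A.map fun w => x w + 1).prod := by
  have := List.map_fst_zip (l₁ := A) (l₂ := Sum.inl 1 :: B) (by simpa using h)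
  rw [allZero, controlPairs]
  conv_rhs => rw [← this]
  rw [List.map_map]; rfl

/-- Multiply by `-1` if all wires except the second ancilla are `0`. -/
def zeroReflection (n : ℕ) : List (Op 2 n) :=
  reflectZero (Sum.inl 1)
    (controlPairs ((mainWires n).take ((n + 2) / 2)) ((mainWires n).drop ((n + 2) / 2)))
    (controlPairs ((mainWires n).drop ((n + 2) / 2)) ((mainWires n).take ((n + 2) / 2)))

/-- Each half of the main wires is borrowed as targets by the other half, the second ancilla heading
both lists. The sign does not depend on that ancilla, whatever it holds. -/
theorem runOps_zeroReflection (hn : 1 ≤ n) (U UI : Matrix (SysBasis n) (SysBasis n) ℂ)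
    (ψ : State 2 n) :
    runOps U UI (zeroReflection n) ψ =
      fun x => if ∀ w, w ≠ Sum.inl 1 → x w = 0 then -ψ x else ψ x := by
  have hlen : (mainWires n).length = n + 1 := by simp [mainWires]
  have hnd : (mainWires n).Nodup := by
    refine List.nodup_cons.2 ⟨by simp, (List.nodup_finRange n).map Sum.inr_injective⟩
  have h1 : (Sum.inl 1 : Wire 2 n) ∉ mainWires n := by simp [mainWires]
  set A := (mainWires n).take ((n + 2) / 2) with hA
  set B := (mainWires n).drop ((n + 2) / 2) with hB
  have hAB : A ++ B = mainWires n := List.take_append_drop _ _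
  have hdis : A.Disjoint B := List.disjoint_of_nodup_append (hAB ▸ hnd)
  have hA1 : Sum.inl 1 ∉ A := fun h => h1 (List.mem_of_mem_take h)
  have hB1 : Sum.inl 1 ∉ B := fun h => h1 (List.mem_of_mem_drop h)
  have hAl : A.length = (n + 2) / 2 := by rw [hA, List.length_take, hlen]; omega
  have hBl : B.length = n + 1 - (n + 2) / 2 := by rw [hB, List.length_drop, hlen]
  have hLA : LadderWires (controlPairs A B) := ladderWires_controlPairs (hnd.sublist (List.drop_sublist _ _)) hA1 hB1 hdis
  have hLB : LadderWires (controlPairs B A) := ladderWires_controlPairs (hnd.sublist (List.take_sublist _ _)) hB1 hA1 hdis.symm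
  -- Splitting at `(n + 2) / 2` gives halves whose lengths differ by at most one, so with the extra
  -- ancilla each control has a target and `zip` drops no control.
  have hzA := allZero_controlPairs (A := A) (B := B) (by omega)
  have hzB := allZero_controlPairs (A := B) (B := A) (by omega)
  have hprod : ∀ x, allZero (controlPairs A B) x * allZero (controlPairs B A) x =
      ((mainWires n).map fun w => x w + 1).prod := by
    intro x
    rw [hzA, hzB, ← List.prod_append, ← List.map_append, hAB]
  rw [zeroReflection, ← hA, ← hB]
  -- Both halves are nonempty because there are at least two main wires; this is where `1 ≤ n`
  -- enters.
  obtain ⟨a, A', hA'⟩ := List.exists_cons_of_length_pos (l := A) (by omega)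
  obtain ⟨b, B', hB'⟩ := List.exists_cons_of_length_pos (l := B) (by omega)
  have eA : controlPairs A B = (a, Sum.inl 1) :: A'.zip B := by rw [controlPairs, hA']; rfl
  have eB : controlPairs B A = (b, Sum.inl 1) :: B'.zip A := by rw [controlPairs, hB']; rfl
  have := runOps_reflectZero U UI (p := (a, Sum.inl 1)) (p' := (b, Sum.inl 1)) (eA ▸ hLA)
    (eB ▸ hLB) rfl ψ
  rw [← eA, ← eB] at this
  rw [this]
  funext x
  rw [hprod]
  split_ifs with hx
  · have : ((mainWires n).map fun w => x w + 1).prod = 1 := by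
      refine List.prod_eq_one fun y hy => ?_
      obtain ⟨w, hw, rfl⟩ := List.mem_map.1 hy
      rw [hx w (by rintro rfl; exact h1 hw)]; rfl
    rw [this]; simp [parity]
  · push Not at hx
    obtain ⟨w, hw, hxw⟩ := hx
    have : ((mainWires n).map fun w => x w + 1).prod = 0 := by
      have hw' : w ∈ mainWires n := by
        rcases w with i | j
        · have : i = 0 := by
            have : i ≠ 1 := fun h => hw (by rw [h])
            omega
          simp [mainWires, this]
        · simp [mainWires]
      refine prod_eq_zero_of_mem (List.mem_map.2 ⟨w, hw', ?_⟩)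
      have : ∀ a : Fin 2, a ≠ 0 → a + 1 = 0 := by decide
      exact this _ hxw
    rw [this]; simp [parity]

/-! ### Cost of the reflection -/

theorem ctrlGate_costs (c t : Wire m n) (W : Fin 2 → Matrix.unitaryGroup (Fin 2) ℂ) :
    (ctrlGate c t W).uCost = 0 ∧ (ctrlGate c t W).uiCost = 0 ∧ (ctrlGate c t W).gateCost = 1 := by
  unfold ctrlGate
  split_ifs <;> simp [Op.uCost, Op.uiCost, Op.gateCost]

/-- A list of operations that consists of at most `k` one- and two-qubit gates. -/
def GatesOnly (l : List (Op m n)) (k : ℕ) : Prop :=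
  opsCost Op.uCost l = 0 ∧ opsCost Op.uiCost l = 0 ∧ opsCost Op.gateCost l ≤ k

theorem GatesOnly.append {l l' : List (Op m n)} {k k' : ℕ} (h : GatesOnly l k)
    (h' : GatesOnly l' k') : GatesOnly (l ++ l') (k + k') := by
  simp only [GatesOnly, opsCost_append] at *
  omega

theorem gatesOnly_toffoli (c a t : Wire m n) : GatesOnly (toffoli c a t) 5 := by
  simp [GatesOnly, toffoli, negCtrlNot, ctrlGate_costs]

theorem gatesOnly_ladder (L : List (Wire m n × Wire m n)) :
    GatesOnly (ladder L) (10 * L.length) := by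
  induction L with
  | nil => simp [GatesOnly, ladder]
  | cons p l ih =>
    cases l with
    | nil => simp [GatesOnly, ladder, negCtrlNot, ctrlGate_costs]
    | cons q l =>
      have h := ((gatesOnly_toffoli p.1 q.2 p.2).append (ih.append (gatesOnly_toffoli p.1 q.2 p.2)))
      refine ⟨h.1, h.2.1, h.2.2.trans ?_⟩
      simp only [List.length_cons]; omega

theorem gatesOnly_multiCtrlNot (L : List (Wire m n × Wire m n)) :
    GatesOnly (multiCtrlNot L) (20 * L.length) := by
  have h := (gatesOnly_ladder L).append (gatesOnly_ladder L.tail)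
  refine ⟨h.1, h.2.1, h.2.2.trans ?_⟩
  rw [List.length_tail]; omega

theorem gatesOnly_multiCtrlZ (t : Wire m n) (L : List (Wire m n × Wire m n)) :
    GatesOnly (multiCtrlZ t L) (20 * L.length + 2) := by
  have h := gatesOnly_multiCtrlNot L
  simp only [GatesOnly, multiCtrlZ, opsCost_cons, opsCost_append, opsCost_nil, Op.uCost, Op.uiCost,
    Op.gateCost] at *
  omega

theorem gatesOnly_zeroReflection (n : ℕ) : GatesOnly (zeroReflection n) (40 * n + 44) := by
  have hlen : (mainWires n).length = n + 1 := by simp [mainWires]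
  have h1 : ∀ A B : List (Wire 2 n), (controlPairs A B).length ≤ A.length := fun A B => by
    rw [controlPairs, List.length_zip]; exact min_le_left _ _
  have hA := h1 ((mainWires n).take ((n + 2) / 2)) ((mainWires n).drop ((n + 2) / 2))
  have hB := h1 ((mainWires n).drop ((n + 2) / 2)) ((mainWires n).take ((n + 2) / 2))
  rw [List.length_take, hlen] at hA
  rw [List.length_drop, hlen] at hB
  have h := (gatesOnly_multiCtrlNot (controlPairs ((mainWires n).take ((n + 2) / 2))
    ((mainWires n).drop ((n + 2) / 2)))).append ((gatesOnly_multiCtrlZ (Sum.inl 1)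
    (controlPairs ((mainWires n).drop ((n + 2) / 2)) ((mainWires n).take ((n + 2) / 2)))).append
    ((gatesOnly_multiCtrlNot (controlPairs ((mainWires n).take ((n + 2) / 2))
    ((mainWires n).drop ((n + 2) / 2)))).append (gatesOnly_multiCtrlZ (Sum.inl 1)
    (controlPairs ((mainWires n).drop ((n + 2) / 2)) ((mainWires n).take ((n + 2) / 2))))))
  refine ⟨h.1, h.2.1, h.2.2.trans ?_⟩
  omega

end

end GroundStatePrep

namespace GroundStatePrep

noncomputable section

variable {m n : ℕ}

/-! ### Projections and weights -/

theorem State.weight_eq_dotProduct (ψ : State m n) : ((ψ.weight : ℝ) : ℂ) = star ψ ⬝ᵥ ψ := by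
  rw [State.weight, dotProduct, Complex.ofReal_sum]
  refine Finset.sum_congr rfl fun x _ => ?_
  rw [Pi.star_apply, mul_comm, mul_star_eq_norm_sq]

theorem State.weight_nonneg (ψ : State m n) : 0 ≤ ψ.weight :=
  Finset.sum_nonneg fun _ _ => by positivity

theorem State.weight_smul (c : ℂ) (ψ : State m n) : State.weight (c • ψ) = ‖c‖ ^ 2 * ψ.weight := by
  simp [State.weight, Finset.mul_sum, mul_pow]

theorem State.init_eq_single (m n : ℕ) : State.init m n = Pi.single (fun _ => 0) 1 := by
  funext x
  simp only [init, withZeroAncilla, sysZero, Pi.single_apply]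
  by_cases h : x = fun _ => 0
  · subst h; simp
  · rw [if_neg h]
    split_ifs with h1 h2
    · refine absurd (funext fun i => ?_) h
      rcases i with i | j
      · exact h1 i
      · exact congrFun h2 j
    · rfl
    · rfl

theorem star_init_dotProduct (ψ : State m n) : star (State.init m n) ⬝ᵥ ψ = ψ fun _ => 0 := by
  rw [State.init_eq_single, ← Pi.single_star, star_one, single_one_dotProduct]

theorem State.weight_init (m n : ℕ) : (State.init m n).weight = 1 := by
  apply Complex.ofReal_injective
  rw [State.weight_eq_dotProduct, star_init_dotProduct, State.init_eq_single]
  simp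

theorem star_dotProduct_project (q : Wire m n) (b : Fin 2) (ψ : State m n) :
    star ψ ⬝ᵥ project q b ψ = ((project q b ψ).weight : ℂ) := by
  rw [State.weight_eq_dotProduct, dotProduct, dotProduct]
  refine Finset.sum_congr rfl fun x _ => ?_
  simp only [project, Pi.star_apply]
  split_ifs <;> simp

theorem weight_project_add (q : Wire m n) (ψ : State m n) :
    (project q 0 ψ).weight + (project q 1 ψ).weight = ψ.weight := by
  simp only [State.weight, project, ← Finset.sum_add_distrib]
  refine Finset.sum_congr rfl fun x _ => ?_
  have two : ∀ a : Fin 2, a = 0 ∨ a = 1 := by decide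
  rcases two (x q) with h | h <;> simp [h]

/-! ### Lists of operations that do not touch the second ancilla -/

/-- The part of a state in which the second ancilla is `0`. -/
def spareZero (ψ : State 2 n) : State 2 n := project (Sum.inl 1) 0 ψ

/-- The operations commute with the projection onto the value `0` of the second ancilla. -/
def KeepsSpare (U UI : Matrix (SysBasis n) (SysBasis n) ℂ) (l : List (Op 2 n)) : Prop :=
  ∀ ψ, runOps U UI l (spareZero ψ) = spareZero (runOps U UI l ψ)

theorem act_spareZero {R : Type*} [Fintype R] (L : Register (Wire 2 n → Fin 2) R)
    (hL : ∀ x r, L.put x r (Sum.inl 1) = x (Sum.inl 1))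
    (A : (Wire 2 n → Fin 2) → Matrix R R ℂ) (ψ : State 2 n) :
    L.act A (spareZero ψ) = spareZero (L.act A ψ) := by
  funext x
  simp only [Register.act, spareZero, project, hL]
  split_ifs <;> simp

section Fixed

variable {U UI : Matrix (SysBasis n) (SysBasis n) ℂ}

theorem keepsSpare_nil : KeepsSpare U UI [] := fun _ => rfl

theorem KeepsSpare.append {l l' : List (Op 2 n)} (h : KeepsSpare U UI l)
    (h' : KeepsSpare U UI l') : KeepsSpare U UI (l ++ l') := fun ψ => by
  rw [runOps_append, runOps_append, h, h']

theorem keepsSpare_one (V : Matrix.unitaryGroup (Fin 2) ℂ) :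
    KeepsSpare U UI [Op.one (Sum.inl 0) V] := fun ψ => by
  simp only [runOps_cons, runOps_nil, Op.apply, applyOne_eq_act]
  have hne : (Sum.inl 1 : Wire 2 n) ≠ Sum.inl 0 := by simp
  exact act_spareZero (wireRegister (Sum.inl 0)) (fun x r => Function.update_of_ne hne r x) _ ψ

theorem keepsSpare_queryCtrlU (a : Fin 2) (inv : Bool) :
    KeepsSpare U UI [Op.queryCtrlU a inv] := fun ψ => by
  simp only [runOps_cons, runOps_nil, Op.apply, applyCtrlSys_eq_act]
  exact act_spareZero _ (fun x r => rfl) _ _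

theorem keepsSpare_queryUI (inv : Bool) : KeepsSpare U UI [Op.queryUI inv] := fun ψ => by
  simp only [runOps_cons, runOps_nil, Op.apply, applySys_eq_act]
  exact act_spareZero _ (fun x r => rfl) _ _

theorem keepsSpare_zeroReflection (hn : 1 ≤ n) : KeepsSpare U UI (zeroReflection n) := fun ψ => by
  rw [runOps_zeroReflection hn, runOps_zeroReflection hn]
  funext x
  simp only [spareZero, project]
  split_ifs <;> simp

/-- A unitary that commutes with a projection has an inverse that commutes with it. -/
theorem KeepsSpare.inverseOps (hU : U ∈ Matrix.unitaryGroup (SysBasis n) ℂ)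
    (hUI : UI ∈ Matrix.unitaryGroup (SysBasis n) ℂ) {l : List (Op 2 n)} (h : KeepsSpare U UI l) :
    KeepsSpare U UI (inverseOps l) := fun ψ => by
  have h1 := h (runOps U UI (GroundStatePrep.inverseOps l) ψ)
  rw [runOps_runOps_inverseOps hU hUI] at h1
  have h2 := runOps_runOps_inverseOps hU hUI (GroundStatePrep.inverseOps l)
    (spareZero (runOps U UI (GroundStatePrep.inverseOps l) ψ))
  rw [inverseOps_inverseOps, h1] at h2
  exact h2

/-! ### Amplitude amplification -/

/-- The part of a state in which the first ancilla is `0`. -/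
def goodPart (ψ : State 2 n) : State 2 n := project (Sum.inl 0) 0 ψ

theorem goodPart_smul_add (c : ℂ) (φ ψ : State 2 n) :
    goodPart (c • φ + ψ) = c • goodPart φ + goodPart ψ := by
  funext x
  simp only [goodPart, project, Pi.add_apply, Pi.smul_apply]
  split_ifs <;> simp

theorem goodPart_goodPart (ψ : State 2 n) : goodPart (goodPart ψ) = goodPart ψ := by
  funext x
  simp only [goodPart, project]
  split_ifs <;> simp

/-- The matrix `diag (-1, 1)`. -/
def negateZero : Matrix.unitaryGroup (Fin 2) ℂ :=
  ⟨!![-1, 0; 0, 1], mem_unitaryGroup_two _ _ _ _ (by simp) (by simp) (by simp)⟩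

theorem negateZero_apply (ψ : State 2 n) :
    (Op.one (Sum.inl 0) negateZero).apply U UI ψ = (-2 : ℂ) • goodPart ψ + ψ := by
  funext x
  simp only [Op.apply, applyOne, negateZero, Fin.sum_univ_two, goodPart, project, Pi.add_apply,
    Pi.smul_apply, smul_eq_mul]
  have two : ∀ a : Fin 2, a = 0 ∨ a = 1 := by decide
  rcases two (x (Sum.inl 0)) with h | h
  · have := Function.update_eq_self (Sum.inl 0) x
    rw [h] at this
    simp only [h, this]
    simp
    ring
  · have := Function.update_eq_self (Sum.inl 0) x
    rw [h] at this
    simp [h, this]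

/-- One round of amplitude amplification of the preparation `l`. -/
def amplify (l : List (Op 2 n)) : List (Op 2 n) :=
  l ++ (Op.one (Sum.inl 0) negateZero :: (inverseOps l ++ (zeroReflection n ++ l)))

/-- The circuit negates two basis states, one for each value of the second ancilla. Only where that
ancilla is `0` is it the reflection about the initial state, and for this reason `KeepsSpare` is
carried along. -/
theorem runOps_zeroReflection_of_spareZero (hn : 1 ≤ n) {ψ : State 2 n} (hψ : spareZero ψ = ψ) :
    runOps U UI (zeroReflection n) ψ =
      (-2 * (star (State.init 2 n) ⬝ᵥ ψ)) • State.init 2 n + ψ := by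
  rw [runOps_zeroReflection hn, star_init_dotProduct, State.init_eq_single]
  funext x
  simp only [Pi.add_apply, Pi.smul_apply, smul_eq_mul, Pi.single_apply]
  by_cases hx : x = fun _ => 0
  · subst hx
    simp
    ring
  · rw [if_neg hx]
    split_ifs with h
    · have h1 : x (Sum.inl 1) ≠ 0 := fun h1 => hx (funext fun w => by
        by_cases hw : w = Sum.inl 1
        · rw [hw, h1]
        · exact h w hw)
      have : ψ x = 0 := by
        rw [← hψ]; simp [spareZero, project, h1]
      simp [this]
    · simp

theorem KeepsSpare.amplify (hn : 1 ≤ n) (hU : U ∈ Matrix.unitaryGroup (SysBasis n) ℂ)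
    (hUI : UI ∈ Matrix.unitaryGroup (SysBasis n) ℂ) {l : List (Op 2 n)} (h : KeepsSpare U UI l) :
    KeepsSpare U UI (amplify l) :=
  h.append ((keepsSpare_one negateZero).append
    ((h.inverseOps hU hUI).append ((keepsSpare_zeroReflection hn).append h)))

theorem spareZero_init : spareZero (State.init 2 n) = State.init 2 n := by
  rw [State.init_eq_single]
  funext x
  simp only [spareZero, project, Pi.single_apply]
  by_cases hx : x = fun _ => 0 <;> simp [hx]

/-- The success probability of a preparation. -/
def goodWeight (U UI : Matrix (SysBasis n) (SysBasis n) ℂ) (l : List (Op 2 n)) : ℝ :=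
  State.weight (goodPart (runOps U UI l (State.init 2 n)))

theorem weight_runOps_init (hU : U ∈ Matrix.unitaryGroup (SysBasis n) ℂ)
    (hUI : UI ∈ Matrix.unitaryGroup (SysBasis n) ℂ) (l : List (Op 2 n)) :
    State.weight (runOps U UI l (State.init 2 n)) = 1 := by
  apply Complex.ofReal_injective
  rw [State.weight_eq_dotProduct, star_runOps_dotProduct_runOps hU hUI,
    ← State.weight_eq_dotProduct, State.weight_init]

theorem goodWeight_le_one (hU : U ∈ Matrix.unitaryGroup (SysBasis n) ℂ)
    (hUI : UI ∈ Matrix.unitaryGroup (SysBasis n) ℂ) (l : List (Op 2 n)) :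
    goodWeight U UI l ≤ 1 := by
  have h := weight_project_add (Sum.inl 0) (runOps U UI l (State.init 2 n))
  rw [weight_runOps_init hU hUI] at h
  have := State.weight_nonneg (project (Sum.inl 0) 1 (runOps U UI l (State.init 2 n)))
  rw [goodWeight, goodPart]
  linarith

/-- With `a` the prepared state, `Π` the projection onto the good part and `g` its weight, a round
yields `a - 2 Π a - 2 (1 - 2 g) a`. Applying `Π` gives `(4 g - 3) Π a`. -/
theorem goodPart_runOps_amplify (hn : 1 ≤ n) (hU : U ∈ Matrix.unitaryGroup (SysBasis n) ℂ)
    (hUI : UI ∈ Matrix.unitaryGroup (SysBasis n) ℂ) {l : List (Op 2 n)} (h : KeepsSpare U UI l) :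
    goodPart (runOps U UI (amplify l) (State.init 2 n)) =
      ((4 * goodWeight U UI l - 3 : ℝ) : ℂ) • goodPart (runOps U UI l (State.init 2 n)) := by
  set a := runOps U UI l (State.init 2 n) with ha
  set v := (-2 : ℂ) • goodPart a + a with hv
  set w := runOps U UI (inverseOps l) v with hw
  have ha_spare : spareZero a = a := by rw [ha, ← h, spareZero_init]
  have hv_spare : spareZero v = v := by
    have := keepsSpare_one (U := U) (UI := UI) negateZero a
    simp only [runOps_cons, runOps_nil, negateZero_apply, ha_spare] at this
    exact this.symm
  have hw_spare : spareZero w = w := by rw [hw, ← h.inverseOps hU hUI, hv_spare]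
  have haa : star a ⬝ᵥ a = 1 := by
    rw [← State.weight_eq_dotProduct, ha, weight_runOps_init hU hUI, Complex.ofReal_one]
  have hag : star a ⬝ᵥ goodPart a = (goodWeight U UI l : ℂ) := star_dotProduct_project _ _ _
  have hc : star (State.init 2 n) ⬝ᵥ w = 1 - 2 * (goodWeight U UI l : ℂ) := by
    rw [hw, star_dotProduct_runOps, inverseOps_inverseOps, ← ha, hv, dotProduct_add,
      dotProduct_smul, haa, hag, smul_eq_mul]
    ring
  have hrun : runOps U UI (amplify l) (State.init 2 n) =
      (-2 * (1 - 2 * (goodWeight U UI l : ℂ))) • a + v := by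
    rw [amplify, runOps_append, ← ha, runOps_cons, negateZero_apply, ← hv, runOps_append, ← hw,
      runOps_append, runOps_zeroReflection_of_spareZero hn hw_spare, hc, runOps_smul_add, ← ha, hw,
      runOps_runOps_inverseOps hU hUI]
  rw [hrun, goodPart_smul_add, hv, goodPart_smul_add, goodPart_goodPart]
  funext x
  simp only [Pi.add_apply, Pi.smul_apply, smul_eq_mul]
  push_cast
  ring

theorem goodWeight_amplify (hn : 1 ≤ n) (hU : U ∈ Matrix.unitaryGroup (SysBasis n) ℂ)
    (hUI : UI ∈ Matrix.unitaryGroup (SysBasis n) ℂ) {l : List (Op 2 n)} (h : KeepsSpare U UI l) :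
    goodWeight U UI (amplify l) = (4 * goodWeight U UI l - 3) ^ 2 * goodWeight U UI l := by
  rw [goodWeight, goodPart_runOps_amplify hn hU hUI h, State.weight_smul, Complex.norm_real,
    Real.norm_eq_abs, sq_abs]
  rfl

/-- `i` nested rounds of amplitude amplification. -/
def amplifyIter (l : List (Op 2 n)) : ℕ → List (Op 2 n)
  | 0 => l
  | i + 1 => amplify (amplifyIter l i)

theorem KeepsSpare.amplifyIter (hn : 1 ≤ n) (hU : U ∈ Matrix.unitaryGroup (SysBasis n) ℂ)
    (hUI : UI ∈ Matrix.unitaryGroup (SysBasis n) ℂ) {l : List (Op 2 n)} (h : KeepsSpare U UI l)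
    (i : ℕ) : KeepsSpare U UI (amplifyIter l i) := by
  induction i with
  | zero => exact h
  | succ i ih => exact ih.amplify hn hU hUI

theorem exists_goodPart_amplifyIter (hn : 1 ≤ n) (hU : U ∈ Matrix.unitaryGroup (SysBasis n) ℂ)
    (hUI : UI ∈ Matrix.unitaryGroup (SysBasis n) ℂ) {l : List (Op 2 n)} (h : KeepsSpare U UI l)
    (i : ℕ) : ∃ c : ℂ, goodPart (runOps U UI (amplifyIter l i) (State.init 2 n)) =
      c • goodPart (runOps U UI l (State.init 2 n)) := by
  induction i with
  | zero => exact ⟨1, (one_smul _ _).symm⟩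
  | succ i ih =>
    obtain ⟨c, hc⟩ := ih
    rw [amplifyIter, goodPart_runOps_amplify hn hU hUI (h.amplifyIter hn hU hUI i), hc, smul_smul]
    exact ⟨_, rfl⟩

/-- `(4 sin² θ - 3)² sin² θ = sin² (3θ)` is the triple-angle formula. Nesting therefore multiplies
the angle by `3 ^ i`. -/
theorem goodWeight_amplifyIter (hn : 1 ≤ n) (hU : U ∈ Matrix.unitaryGroup (SysBasis n) ℂ)
    (hUI : UI ∈ Matrix.unitaryGroup (SysBasis n) ℂ) {l : List (Op 2 n)} (h : KeepsSpare U UI l)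
    {θ : ℝ} (hθ : goodWeight U UI l = Real.sin θ ^ 2) (i : ℕ) :
    goodWeight U UI (amplifyIter l i) = Real.sin (3 ^ i * θ) ^ 2 := by
  induction i with
  | zero => simpa [amplifyIter] using hθ
  | succ i ih =>
    rw [amplifyIter, goodWeight_amplify hn hU hUI (h.amplifyIter hn hU hUI i), ih, pow_succ' 3,
      mul_assoc, Real.sin_three_mul]
    ring

/-- At the first `i` where the angle reaches `π / 6`, the previous angle was smaller, so tripling
cannot exceed `π / 2`. Hence the sine is at least `1/2`. -/
theorem exists_sin_sq_ge {θ : ℝ} (hθ0 : 0 < θ) (hθ : θ ≤ Real.pi / 2) {K : ℕ}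
    (hK : Real.pi / 6 ≤ 3 ^ K * θ) : ∃ i ≤ K, 1 / 4 ≤ Real.sin (3 ^ i * θ) ^ 2 := by
  classical
  have hex : ∃ i, Real.pi / 6 ≤ 3 ^ i * θ := ⟨K, hK⟩
  have hi := Nat.find_spec hex
  refine ⟨Nat.find hex, Nat.find_min' hex hK, ?_⟩
  have hle : 3 ^ Nat.find hex * θ ≤ Real.pi / 2 := by
    rcases Nat.eq_zero_or_pos (Nat.find hex) with h0 | h0
    · rw [h0, pow_zero, one_mul]; exact hθ
    · have h1 := Nat.find_min hex (Nat.sub_lt h0 one_pos)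
      obtain ⟨j, hj⟩ := Nat.exists_eq_succ_of_ne_zero h0.ne'
      rw [hj] at h1 ⊢
      rw [Nat.succ_sub_one, not_le] at h1
      rw [pow_succ]; linarith
  have h := Real.sin_le_sin_of_le_of_le_pi_div_two (by linarith [Real.pi_pos]) hle hi
  rw [Real.sin_pi_div_six] at h
  nlinarith

/-! ### Repeated attempts -/

/-- Run the preparations one after the other from the zero state, until one of them succeeds. -/
def attempts : List (List (Op 2 n)) → Program 2 n
  | [] => .halt false
  | l :: ls => .restart (.afterOps l (.measure (Sum.inl 0)
      fun b => if b = 0 then .halt true else attempts ls))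

theorem cost_attempts (c : Op 2 n → ℕ) (cM cR : ℕ) (ls : List (List (Op 2 n))) :
    (attempts ls).cost c cM cR = (ls.map fun l => opsCost c l + (cM + cR)).sum := by
  induction ls with
  | nil => rfl
  | cons l ls ih =>
    simp only [attempts, Program.cost, Program.cost_afterOps, List.map_cons, List.sum_cons, ← ih]
    simp [Program.cost]
    omega

/-- Restarts make the attempts independent, so the failure probabilities multiply. -/
theorem successProb_attempts (hU : U ∈ Matrix.unitaryGroup (SysBasis n) ℂ)
    (hUI : UI ∈ Matrix.unitaryGroup (SysBasis n) ℂ) (ls : List (List (Op 2 n))) (ψ : State 2 n) :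
    (attempts ls).successProb U UI ψ =
      ψ.weight * (1 - (ls.map fun l => 1 - goodWeight U UI l).prod) := by
  induction ls generalizing ψ with
  | nil => simp [attempts, Program.successProb]
  | cons l ls ih =>
    have h := weight_project_add (Sum.inl 0) (runOps U UI l (State.init 2 n))
    rw [weight_runOps_init hU hUI] at h
    have h' : goodWeight U UI l =
      (project (Sum.inl 0) 0 (runOps U UI l (State.init 2 n))).weight := rfl
    simp only [attempts, Program.successProb, Program.successProb_afterOps, Fin.sum_univ_two,
      List.map_cons, List.prod_cons]
    simp only [one_ne_zero, if_true, if_false, ih, Program.successProb]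
    have h1 : (project (Sum.inl 0) 1 (runOps U UI l (State.init 2 n))).weight =
      1 - (project (Sum.inl 0) 0 (runOps U UI l (State.init 2 n))).weight := by linarith
    rw [h', h1]
    ring

theorem successImplies_attempts (Good : State 2 n → Prop) (ls : List (List (Op 2 n)))
    (h : ∀ l ∈ ls, goodPart (runOps U UI l (State.init 2 n)) ≠ 0 →
      Good (goodPart (runOps U UI l (State.init 2 n)))) (ψ : State 2 n) :
    (attempts ls).SuccessImplies U UI Good ψ := by
  induction ls generalizing ψ with
  | nil => intro h; simp at h
  | cons l ls ih =>
    simp only [attempts, Program.SuccessImplies, Program.successImplies_afterOps]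
    intro _ b
    split_ifs with hb
    · intro _
      subst hb
      exact h l List.mem_cons_self
    · exact ih (fun l' hl' => h l' (List.mem_cons_of_mem _ hl')) _

/-! ### The filtered initial state -/

/-- The circuit of `signalPair`. -/
def signalOps : List (Matrix.unitaryGroup (Fin 2) ℂ) → List (Op 2 n)
  | [] => []
  | R :: l => signalOps l ++ [.queryCtrlU 0 false, .one (Sum.inl 0) R]

/-- The state `|0⟩ ⊗ |φ⟩ + |1⟩ ⊗ |χ⟩` of the first ancilla and the system. -/
def ancillaPair (φ χ : SysBasis n → ℂ) : State 2 n := fun x =>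
  if x (Sum.inl 1) = 0 then
    if x (Sum.inl 0) = 0 then φ fun j => x (Sum.inr j) else χ fun j => x (Sum.inr j)
  else 0

theorem applyCtrlSys_ancillaPair (A : Matrix (SysBasis n) (SysBasis n) ℂ)
    (φ χ : SysBasis n → ℂ) :
    applyCtrlSys 0 A (ancillaPair φ χ) = ancillaPair φ (A *ᵥ χ) := by
  funext x
  have two : ∀ a : Fin 2, a = 0 ∨ a = 1 := by decide
  rcases two (x (Sum.inl 0)) with h | h <;> rcases two (x (Sum.inl 1)) with h' | h' <;>
    simp [applyCtrlSys, applySys, ancillaPair, h, h', Matrix.mulVec, dotProduct]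

theorem applyOne_ancillaPair (R : Matrix (Fin 2) (Fin 2) ℂ) (φ χ : SysBasis n → ℂ) :
    applyOne (Sum.inl 0) R (ancillaPair φ χ) =
      ancillaPair (R 0 0 • φ + R 0 1 • χ) (R 1 0 • φ + R 1 1 • χ) := by
  funext x
  have two : ∀ a : Fin 2, a = 0 ∨ a = 1 := by decide
  rcases two (x (Sum.inl 0)) with h | h <;> rcases two (x (Sum.inl 1)) with h' | h' <;>
    simp [applyOne, ancillaPair, h, h', Fin.sum_univ_two]

-- Controlled-`U` acts on the two ancilla blocks as `diag (1, X)` evaluated at `X = U`, so the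
-- circuit follows the recursion of `signalPair`. No property of `U` is needed.
open Polynomial in
theorem runOps_signalOps (l : List (Matrix.unitaryGroup (Fin 2) ℂ)) (φ : SysBasis n → ℂ) :
    runOps U UI (signalOps l) (ancillaPair φ 0) =
      ancillaPair (aeval U (signalPair l).1 *ᵥ φ) (aeval U (signalPair l).2 *ᵥ φ) := by
  induction l with
  | nil => simp [signalOps, signalPair]
  | cons R l ih =>
    rw [signalOps, runOps_append, ih, runOps_cons, runOps_cons, runOps_nil]
    simp only [Op.apply, maybeAdjoint, applyCtrlSys_ancillaPair, applyOne_ancillaPair, signalPair]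
    have key : ∀ (r s : ℂ) (p q : ℂ[X]), aeval U (C r * p + C s * (X * q)) *ᵥ φ =
        r • (aeval U p *ᵥ φ) + s • (U *ᵥ (aeval U q *ᵥ φ)) := by
      intro r s p q
      rw [map_add, map_mul, map_mul, map_mul, aeval_C, aeval_C, aeval_X, Matrix.add_mulVec,
        ← Algebra.smul_def, ← Algebra.smul_def, Matrix.smul_mulVec, Matrix.smul_mulVec,
        Matrix.mulVec_mulVec]
    rw [key, key]
    rfl

theorem keepsSpare_signalOps (l : List (Matrix.unitaryGroup (Fin 2) ℂ)) :
    KeepsSpare U UI (signalOps l) := by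
  induction l with
  | nil => exact keepsSpare_nil
  | cons R l ih =>
    exact ih.append ((keepsSpare_queryCtrlU 0 false).append (keepsSpare_one R))

/-- Prepare the initial state and filter it. -/
def filterOps (l : List (Matrix.unitaryGroup (Fin 2) ℂ)) : List (Op 2 n) :=
  .queryUI false :: signalOps l

theorem keepsSpare_filterOps (l : List (Matrix.unitaryGroup (Fin 2) ℂ)) :
    KeepsSpare U UI (filterOps l) :=
  (keepsSpare_queryUI false).append (keepsSpare_signalOps l)

theorem goodPart_ancillaPair (φ χ : SysBasis n → ℂ) :
    goodPart (ancillaPair φ χ) = withZeroAncilla 2 φ := by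
  funext x
  have two : ∀ a : Fin 2, a = 0 ∨ a = 1 := by decide
  rcases two (x (Sum.inl 0)) with h | h <;> rcases two (x (Sum.inl 1)) with h' | h' <;>
    simp [goodPart, project, ancillaPair, withZeroAncilla, h, h', Fin.forall_fin_two]

theorem applySys_init (A : Matrix (SysBasis n) (SysBasis n) ℂ) :
    applySys A (State.init 2 n) = ancillaPair (A *ᵥ sysZero n) 0 := by
  funext x
  have two : ∀ a : Fin 2, a = 0 ∨ a = 1 := by decide
  rcases two (x (Sum.inl 0)) with h | h <;> rcases two (x (Sum.inl 1)) with h' | h' <;>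
    simp [applySys, State.init, ancillaPair, withZeroAncilla, h, h', Fin.forall_fin_two,
      Matrix.mulVec, dotProduct]

open Polynomial in
theorem goodPart_runOps_filterOps (l : List (Matrix.unitaryGroup (Fin 2) ℂ)) :
    goodPart (runOps U UI (filterOps l) (State.init 2 n)) =
      withZeroAncilla 2 (aeval U (signalPair l).1 *ᵥ (UI *ᵥ sysZero n)) := by
  rw [filterOps, runOps_cons, Op.apply, maybeAdjoint, if_neg (by decide), applySys_init,
    runOps_signalOps, goodPart_ancillaPair]

theorem weight_withZeroAncilla (φ : SysBasis n → ℂ) :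
    State.weight (withZeroAncilla 2 φ) = ∑ y, ‖φ y‖ ^ 2 := by
  rw [State.weight, ← (Equiv.sumArrowEquivProdArrow (Fin 2) (Fin n) (Fin 2)).symm.sum_comp,
    Fintype.sum_prod_type, Finset.sum_eq_single (fun _ => 0)]
  · simp [withZeroAncilla, Equiv.sumArrowEquivProdArrow]
  · intro b _ hb
    refine Finset.sum_eq_zero fun y _ => ?_
    have : withZeroAncilla 2 φ ((Equiv.sumArrowEquivProdArrow (Fin 2) (Fin n) (Fin 2)).symm (b, y)) = 0 :=
      if_neg fun h => hb (funext h)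
    rw [this]; simp
  · simp

end Fixed

/-! ### Costs of the amplified filter -/

theorem opsCost_amplify {c : Op 2 n → ℕ} (hc : ∀ g, c g.inverse = c g) (l : List (Op 2 n)) :
    opsCost c (amplify l) = 3 * opsCost c l + (c (Op.one (Sum.inl 0) negateZero) +
      opsCost c (zeroReflection n)) := by
  simp only [amplify, opsCost_append, opsCost_cons, opsCost_inverseOps hc]
  ring

/-- Adding `r` to the cost turns the recursion `x ↦ 3 x + r` into one dominated by plain tripling.
-/
theorem opsCost_amplifyIter_le {c : Op 2 n → ℕ} (hc : ∀ g, c g.inverse = c g) {r : ℕ}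
    (hr : c (Op.one (Sum.inl 0) negateZero) + opsCost c (zeroReflection n) ≤ r)
    (l : List (Op 2 n)) (i : ℕ) : opsCost c (amplifyIter l i) + r ≤ 3 ^ i * (opsCost c l + r) := by
  induction i with
  | zero => simp [amplifyIter]
  | succ i ih =>
    rw [amplifyIter, opsCost_amplify hc, pow_succ]
    calc _ ≤ 3 * (opsCost c (amplifyIter l i) + r) := by omega
      _ ≤ 3 * (3 ^ i * (opsCost c l + r)) := by omega
      _ = _ := by ring

theorem opsCost_signalOps (c : Op 2 n → ℕ) (u g : ℕ) (hu : c (.queryCtrlU 0 false) = u)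
    (hg : ∀ V, c (.one (Sum.inl 0) V) = g) (l : List (Matrix.unitaryGroup (Fin 2) ℂ)) :
    opsCost c (signalOps l) = l.length * (u + g) := by
  induction l with
  | nil => simp [signalOps]
  | cons R l ih =>
    simp only [signalOps, opsCost_append, ih, opsCost_cons, opsCost_nil, hu, hg, List.length_cons]
    ring

/-- Four sweeps over `0, …, K` rounds of amplification. -/
def sweeps (l : List (Op 2 n)) (K : ℕ) : List (List (Op 2 n)) :=
  (List.replicate 4 ((List.range (K + 1)).map (amplifyIter l))).flatten

theorem cost_sweeps_le {c : Op 2 n → ℕ} (hc : ∀ g, c g.inverse = c g) {r : ℕ} (cM cR : ℕ)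
    (hr : c (Op.one (Sum.inl 0) negateZero) + opsCost c (zeroReflection n) ≤ r)
    (l : List (Op 2 n)) (K : ℕ) :
    (attempts (sweeps l K)).cost c cM cR ≤ 6 * 3 ^ K * (opsCost c l + r + (cM + cR)) := by
  -- The geometric series `∑ 3 ^ i ≤ 3 * 3 ^ K / 2` over one sweep; four sweeps give the factor `6`.
  have h1 : ∀ K : ℕ, 2 * (((List.range (K + 1)).map (amplifyIter l)).map
      fun l => opsCost c l + (cM + cR)).sum ≤ 3 * 3 ^ K * (opsCost c l + r + (cM + cR)) := by
    intro K
    induction K with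
    | zero =>
      simp [amplifyIter]; omega
    | succ K ih =>
      have h2 := opsCost_amplifyIter_le hc hr l (K + 1)
      have h3 : 1 ≤ 3 ^ (K + 1) := Nat.one_le_pow _ _ (by norm_num)
      have h4 : (cM + cR) ≤ 3 ^ (K + 1) * (cM + cR) := Nat.le_mul_of_pos_left _ h3
      rw [List.range_succ, List.map_append, List.map_append, List.sum_append]
      simp only [List.map_cons, List.map_nil, List.sum_cons, List.sum_nil]
      have h5 : 3 * 3 ^ K * (opsCost c l + r + (cM + cR)) =
        3 ^ (K + 1) * (opsCost c l + r) + 3 ^ (K + 1) * (cM + cR) := by ring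
      have h6 : 3 * 3 ^ (K + 1) * (opsCost c l + r + (cM + cR)) =
        3 * (3 ^ (K + 1) * (opsCost c l + r)) + 3 * (3 ^ (K + 1) * (cM + cR)) := by ring
      omega
  rw [cost_attempts, sweeps]
  have h2 := h1 K
  simp only [List.replicate, List.flatten_cons, List.flatten_nil, List.map_append, List.sum_append,
    List.append_nil]
  have h3 : 6 * 3 ^ K * (opsCost c l + r + (cM + cR)) =
    2 * (3 * 3 ^ K * (opsCost c l + r + (cM + cR))) := by ring
  omega

/-! ### Success probability and final state of the sweeps -/

section Success

variable {U UI : Matrix (SysBasis n) (SysBasis n) ℂ}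

theorem successProb_sweeps (hn : 1 ≤ n) (hU : U ∈ Matrix.unitaryGroup (SysBasis n) ℂ)
    (hUI : UI ∈ Matrix.unitaryGroup (SysBasis n) ℂ) {l : List (Op 2 n)} (h : KeepsSpare U UI l)
    {s : ℝ} (hs0 : 0 < s) (hs : s ^ 2 ≤ goodWeight U UI l) {K : ℕ}
    (hK : Real.pi / 6 ≤ 3 ^ K * s) :
    2 / 3 ≤ (attempts (sweeps l K)).successProb U UI (State.init 2 n) := by
  have hle1 := goodWeight_le_one hU hUI
  have hge0 : ∀ l, 0 ≤ goodWeight U UI l := fun l => State.weight_nonneg _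
  set t := √(goodWeight U UI l) with ht
  have ht1 : t ≤ 1 := Real.sqrt_le_one.2 (hle1 l)
  have ht0 : 0 ≤ t := Real.sqrt_nonneg _
  have hst : s ≤ t := Real.le_sqrt_of_sq_le hs
  have hθ : goodWeight U UI l = Real.sin (Real.arcsin t) ^ 2 := by
    rw [Real.sin_arcsin (by linarith) ht1, ht, Real.sq_sqrt (hge0 l)]
  -- `arcsin t ≥ t` turns the lower bound on the amplitude into one on the angle.
  have htθ : t ≤ Real.arcsin t := by
    have h1 := Real.sin_le (Real.arcsin_nonneg.2 ht0)
    rwa [Real.sin_arcsin (by linarith) ht1] at h1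
  obtain ⟨i, hi, hi4⟩ := exists_sin_sq_ge (θ := Real.arcsin t) (by linarith)
    (Real.arcsin_le_pi_div_two t) (K := K)
    (hK.trans (mul_le_mul_of_nonneg_left (hst.trans htθ) (by positivity)))
  rw [← goodWeight_amplifyIter hn hU hUI h hθ i] at hi4
  set S := ((List.range (K + 1)).map (amplifyIter l)).map fun l => 1 - goodWeight U UI l with hS
  have hprod : 0 ≤ S.prod ∧ S.prod ≤ 3 / 4 := by
    have hall : ∀ S : List ℝ, (∀ y ∈ S, 0 ≤ y ∧ y ≤ 1) → 0 ≤ S.prod ∧ S.prod ≤ 1 := by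
      intro S
      induction S with
      | nil => simp
      | cons y S ih =>
        intro hy
        have h1 := ih fun z hz => hy z (List.mem_cons_of_mem _ hz)
        have h2 := hy y List.mem_cons_self
        rw [List.prod_cons]
        exact ⟨mul_nonneg h2.1 h1.1, mul_le_one₀ h2.2 h1.1 h1.2⟩
    have hmem : ∀ y ∈ S, 0 ≤ y ∧ y ≤ 1 := by
      intro y hy
      obtain ⟨l', -, rfl⟩ := List.mem_map.1 hy
      exact ⟨by linarith [hle1 l'], by linarith [hge0 l']⟩
    -- The good depth contributes a factor at most `3/4` to the failure probability of a sweep; the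
    -- others are bounded by `1`.
    have hin : 1 - goodWeight U UI (amplifyIter l i) ∈ S :=
      List.mem_map_of_mem (List.mem_map_of_mem (List.mem_range.2 (by omega)))
    obtain ⟨S₁, S₂, hS12⟩ := List.append_of_mem hin
    rw [hS12] at hmem ⊢
    have h1 := hall S₁ fun y hy => hmem y (by simp [hy])
    have h2 := hall S₂ fun y hy => hmem y (by simp [hy])
    have h3 := hmem _ (by simp : 1 - goodWeight U UI (amplifyIter l i) ∈ _)
    rw [List.prod_append, List.prod_cons]
    refine ⟨mul_nonneg h1.1 (mul_nonneg h3.1 h2.1), ?_⟩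
    have h4 : (1 - goodWeight U UI (amplifyIter l i)) * S₂.prod ≤ 3 / 4 := by nlinarith
    have h5 : 0 ≤ (1 - goodWeight U UI (amplifyIter l i)) * S₂.prod := mul_nonneg h3.1 h2.1
    nlinarith
  rw [successProb_attempts hU hUI, State.weight_init, one_mul, sweeps]
  simp only [List.replicate, List.flatten_cons, List.flatten_nil, List.map_append,
    List.prod_append, List.append_nil, ← hS]
  -- `(3/4)⁴ = 81/256 < 1/3`, whereas three sweeps would not suffice with this bound.
  have h4 : S.prod ^ 4 ≤ (3 / 4) ^ 4 := pow_le_pow_left₀ hprod.1 hprod.2 4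
  have h5 : S.prod * (S.prod * (S.prod * S.prod)) = S.prod ^ 4 := by ring
  rw [h5]
  norm_num at h4
  linarith

/-- Amplification only rescales the good part, so it suffices to examine the unamplified preparation
up to a scalar. -/
theorem successImplies_sweeps (hn : 1 ≤ n) (hU : U ∈ Matrix.unitaryGroup (SysBasis n) ℂ)
    (hUI : UI ∈ Matrix.unitaryGroup (SysBasis n) ℂ) {l : List (Op 2 n)} (h : KeepsSpare U UI l)
    {Good : State 2 n → Prop}
    (hg : ∀ c : ℂ, Good (c • goodPart (runOps U UI l (State.init 2 n)))) (K : ℕ) (ψ : State 2 n) :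
    (attempts (sweeps l K)).SuccessImplies U UI Good ψ := by
  refine successImplies_attempts Good _ (fun l' hl' _ => ?_) ψ
  obtain ⟨L, hL, hl'⟩ := List.mem_flatten.1 hl'
  rw [List.eq_of_mem_replicate hL] at hl'
  obtain ⟨i, -, rfl⟩ := List.mem_map.1 hl'
  obtain ⟨c, hc⟩ := exists_goodPart_amplifyIter hn hU hUI h i
  rw [hc]
  exact hg c

end Success

end

end GroundStatePrep

namespace GroundStatePrep

noncomputable section

/-! ### Spectral analysis -/

section Spectral

variable {ι : Type*} [Fintype ι]

theorem star_dotProduct_self_eq_sum (φ : ι → ℂ) : star φ ⬝ᵥ φ = ((∑ i, ‖φ i‖ ^ 2 : ℝ) : ℂ) := by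
  rw [dotProduct, Complex.ofReal_sum]
  refine Finset.sum_congr rfl fun x _ => ?_
  rw [Pi.star_apply, mul_comm, mul_star_eq_norm_sq]

variable [DecidableEq ι]

theorem exists_diagonalization {H : Matrix ι ι ℂ} (hH : H.IsHermitian) :
    ∃ V ∈ Matrix.unitaryGroup ι ℂ, ∃ E : ι → ℝ, (∀ i, E i ∈ spectrum ℝ H) ∧
      H = V * Matrix.diagonal (fun i => (E i : ℂ)) * Vᴴ := by
  refine ⟨hH.eigenvectorUnitary, hH.eigenvectorUnitary.2, hH.eigenvalues,
    hH.eigenvalues_mem_spectrum_real, ?_⟩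
  have h := hH.spectral_theorem
  rw [Unitary.conjStarAlgAut_apply] at h
  exact h

theorem exp_conj_diagonal {V : Matrix ι ι ℂ} (hV : V ∈ Matrix.unitaryGroup ι ℂ) (E : ι → ℝ) :
    NormedSpace.exp ((-Complex.I) • (V * Matrix.diagonal (fun i => (E i : ℂ)) * Vᴴ)) =
      V * Matrix.diagonal (fun i => Complex.exp (-(E i * Complex.I))) * Vᴴ := by
  have h1 : V * Vᴴ = 1 := Matrix.mem_unitaryGroup_iff.1 hV
  have h2 : V⁻¹ = Vᴴ := Matrix.inv_eq_right_inv h1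
  have h3 : (-Complex.I) • (V * Matrix.diagonal (fun i => (E i : ℂ)) * Vᴴ) =
      V * Matrix.diagonal (fun i => -(E i * Complex.I)) * V⁻¹ := by
    rw [h2, ← Matrix.smul_mul, ← Matrix.mul_smul, ← Matrix.diagonal_smul]
    congr 3
    funext i
    simp only [Pi.smul_apply, smul_eq_mul]
    ring
  have hunit : IsUnit V := IsUnit.of_mul_eq_one _ h1
  rw [h3, Matrix.exp_conj _ _ hunit, Matrix.exp_diagonal, h2]
  congr 3
  funext i
  rw [Pi.coe_exp, Complex.exp_eq_exp_ℂ]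

theorem conj_diagonal_mem_unitaryGroup {V : Matrix ι ι ℂ} (hV : V ∈ Matrix.unitaryGroup ι ℂ)
    {z : ι → ℂ} (hz : ∀ i, ‖z i‖ = 1) :
    V * Matrix.diagonal z * Vᴴ ∈ Matrix.unitaryGroup ι ℂ := by
  refine mul_mem (mul_mem hV ?_) (Unitary.star_mem hV)
  rw [Matrix.mem_unitaryGroup_iff, Matrix.star_eq_conjTranspose, Matrix.diagonal_conjTranspose,
    Matrix.diagonal_mul_diagonal, ← Matrix.diagonal_one]
  congr 1
  funext i
  rw [Pi.star_apply, mul_star_eq_norm_sq, hz]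
  simp

open Polynomial in
theorem aeval_conj_diagonal {V : Matrix ι ι ℂ} (hV : V ∈ Matrix.unitaryGroup ι ℂ) (z : ι → ℂ)
    (P : ℂ[X]) : aeval (V * Matrix.diagonal z * Vᴴ) P =
      V * Matrix.diagonal (fun i => P.eval (z i)) * Vᴴ := by
  have h1 : V * Matrix.diagonal z * Vᴴ =
      Unitary.conjStarAlgAut ℂ _ (⟨V, hV⟩ : unitary (Matrix ι ι ℂ))
        (Matrix.diagonalAlgHom ℂ z) := by
    rw [Unitary.conjStarAlgAut_apply]; rfl
  rw [h1, aeval_algHom_apply, aeval_algHom_apply, Unitary.conjStarAlgAut_apply]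
  have h2 : aeval z P = fun i => P.eval (z i) := by
    funext i
    have := aeval_algHom_apply (Pi.evalAlgHom ℂ (fun _ : ι => ℂ) i) z P
    rw [Pi.evalAlgHom_apply, Pi.evalAlgHom_apply] at this
    rw [← this, coe_aeval_eq_eval]
  rw [h2]
  rfl

theorem star_mulVec_dotProduct_mulVec {V : Matrix ι ι ℂ} (hV : V ∈ Matrix.unitaryGroup ι ℂ)
    (φ ψ : ι → ℂ) : star (V *ᵥ φ) ⬝ᵥ (V *ᵥ ψ) = star φ ⬝ᵥ ψ := by
  have h : Vᴴ * V = 1 := Matrix.mem_unitaryGroup_iff'.1 hV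
  rw [Matrix.star_mulVec, ← Matrix.dotProduct_mulVec, Matrix.mulVec_mulVec, h, Matrix.one_mulVec]

/-- In an eigenbasis, a nondegenerate ground state is a basis vector up to a phase. -/
theorem exists_index_ground {E : ι → ℝ} {d : ι → ℂ} {E₀ E₁ : ℝ} (hd : star d ⬝ᵥ d = 1)
    (hE₀ : ∀ i, (E i : ℂ) * d i = E₀ * d i) (hE : E₀ < E₁)
    (hE₁ : ∀ (v : ι → ℂ) (e : ℝ), v ≠ 0 → star d ⬝ᵥ v = 0 → (∀ i, (E i : ℂ) * v i = e * v i) →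
      E₁ ≤ e) :
    ∃ i₀, ‖d i₀‖ = 1 ∧ E i₀ = E₀ ∧ ∀ i, i ≠ i₀ → d i = 0 ∧ E₁ ≤ E i := by
  have hex : ∃ i₀, d i₀ ≠ 0 := by
    by_contra! h
    have : d = 0 := funext h
    rw [this] at hd
    simp at hd
  obtain ⟨i₀, hi₀⟩ := hex
  have hEi : ∀ i, d i ≠ 0 → E i = E₀ := fun i hi => by
    exact_mod_cast mul_right_cancel₀ hi (hE₀ i)
  have huniq : ∀ i, i ≠ i₀ → d i = 0 := by
    intro i hi
    by_contra hdi
    -- Two nonzero coordinates would allow a combination of the two basis vectors orthogonal to `d`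
    -- and still of energy `E₀`, which contradicts `E₀ < E₁`.
    have h := hE₁ (Pi.single i₀ (star (d i)) - Pi.single i (star (d i₀))) E₀ (by
      intro h0
      have := congrFun h0 i₀
      simp [hi.symm, hdi] at this) (by
      simp [dotProduct_sub, dotProduct_single]
      ring) fun j => by
      by_cases h1 : j = i₀
      · rw [h1, hEi i₀ hi₀]
      · by_cases h2 : j = i
        · rw [h2, hEi i hdi]
        · simp [h1, h2]
    linarith
  refine ⟨i₀, ?_, hEi i₀ hi₀, fun i hi => ⟨huniq i hi, ?_⟩⟩
  · rw [star_dotProduct_self_eq_sum, Finset.sum_eq_single i₀] at hd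
    · have : ‖d i₀‖ ^ 2 = 1 := by exact_mod_cast hd
      nlinarith [norm_nonneg (d i₀)]
    · intro i _ hi
      rw [huniq i hi]; simp
    · simp
  -- Every other basis vector is orthogonal to `d`, hence has energy at least `E₁`.
  · refine hE₁ (Pi.single i 1) (E i) (by simp) (by simp [dotProduct_single, huniq i hi]) fun j => ?_
    by_cases h : j = i
    · rw [h]
    · simp [h]

end Spectral

/-! ### The filtered state is close to the ground state -/

section Filtered

variable {n : ℕ} {η γ Δ μ : ℝ} {H UI : Matrix (SysBasis n) (SysBasis n) ℂ} {ψ₀ : SysBasis n → ℂ}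
  {E₀ E₁ : ℝ}

theorem norm_exp_neg_mul_I (E : ℝ) : ‖Complex.exp (-(E * Complex.I))‖ = 1 := by
  rw [← neg_mul, ← Complex.ofReal_neg]; exact Complex.norm_exp_ofReal_mul_I _

theorem evolution_mem_unitaryGroup (hH : H.IsHermitian) :
    evolution H ∈ Matrix.unitaryGroup (SysBasis n) ℂ := by
  obtain ⟨V, hV, E, -, hE⟩ := exists_diagonalization hH
  rw [evolution, hE, exp_conj_diagonal hV]
  exact conj_diagonal_mem_unitaryGroup hV fun i => norm_exp_neg_mul_I _

theorem mem_spectrum_real_of_mulVec_eq (hH : H.IsHermitian) {v : SysBasis n → ℂ} (hv : v ≠ 0)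
    {e : ℝ} (he : H *ᵥ v = (e : ℂ) • v) : e ∈ spectrum ℝ H := by
  obtain ⟨V, hV, E, hEspec, hE⟩ := exists_diagonalization hH
  have hV1 : V * Vᴴ = 1 := Matrix.mem_unitaryGroup_iff.1 hV
  have hV2 : Vᴴ * V = 1 := Matrix.mem_unitaryGroup_iff'.1 hV
  have h0 : Vᴴ *ᵥ v ≠ 0 := fun h => hv (by
    rw [← Matrix.one_mulVec v, ← hV1, ← Matrix.mulVec_mulVec, h, Matrix.mulVec_zero])
  obtain ⟨i, hi⟩ := Function.ne_iff.1 h0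
  have h1 := congrFun (congrArg (Vᴴ *ᵥ ·) he) i
  simp only [hE, ← Matrix.mulVec_mulVec] at h1
  rw [Matrix.mulVec_mulVec _ Vᴴ V, hV2, Matrix.one_mulVec, Matrix.mulVec_diagonal,
    Matrix.mulVec_smul, Pi.smul_apply, smul_eq_mul] at h1
  have h2 : E i = e := by exact_mod_cast mul_right_cancel₀ hi h1
  exact h2 ▸ hEspec i

/-- Both energies lie in the spectrum, hence in `[η, π - η]`. The filter is thus only needed for `Δ
≤ π`. -/
theorem IsInstance.gap_le_pi (h : IsInstance η γ Δ μ H UI ψ₀ E₀ E₁) (hη : 0 < η) :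
    Δ ≤ Real.pi := by
  obtain ⟨v, hv, -, hHv⟩ := h.excited_isLeast.1
  have h1 := h.spectrum_subset (mem_spectrum_real_of_mulVec_eq h.hermitian hv hHv)
  have h0 := h.spectrum_subset h.energy_isLeast.1
  linarith [h.gap, h1.2, h0.1]

-- In an eigenbasis the filter multiplies each coordinate by `P(e^{-iE})`. The ground coordinate
-- keeps modulus at least `γ / 4`; all others are damped by `δ / 2` and had total weight at most
-- `1`.
open Polynomial in
theorem IsInstance.filtered (h : IsInstance η γ Δ μ H UI ψ₀ E₀ E₁) (hΔ : 0 < Δ)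
    (hη : 0 < η) {P : ℂ[X]} {δ : ℝ}
    (hlarge : ∀ l : ℝ, 0 ≤ l → l ≤ Real.pi → l ≤ μ - Δ / 2 →
      1 / 4 ≤ ‖P.eval (Complex.exp (-(l * Complex.I)))‖)
    (hsmall : ∀ l : ℝ, 0 ≤ l → l ≤ Real.pi → μ + Δ / 2 ≤ l →
      ‖P.eval (Complex.exp (-(l * Complex.I)))‖ ≤ δ / 2) :
    ∃ x : ℝ, γ / 4 ≤ x ∧
      ‖star ψ₀ ⬝ᵥ (aeval (evolution H) P *ᵥ (UI *ᵥ sysZero n))‖ = x ∧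
      x ^ 2 ≤ ∑ y, ‖(aeval (evolution H) P *ᵥ (UI *ᵥ sysZero n)) y‖ ^ 2 ∧
      ∑ y, ‖(aeval (evolution H) P *ᵥ (UI *ᵥ sysZero n)) y‖ ^ 2 ≤ x ^ 2 + (δ / 2) ^ 2 := by
  obtain ⟨V, hV, E, hEspec, hE⟩ := exists_diagonalization h.hermitian
  have hV1 : V * Vᴴ = 1 := Matrix.mem_unitaryGroup_iff.1 hV
  have hV2 : Vᴴ * V = 1 := Matrix.mem_unitaryGroup_iff'.1 hV
  have hV' : Vᴴ ∈ Matrix.unitaryGroup (SysBasis n) ℂ := Unitary.star_mem hV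
  have hrange : ∀ i, 0 ≤ E i ∧ E i ≤ Real.pi := fun i => by
    have := h.spectrum_subset (hEspec i)
    exact ⟨by linarith [this.1], by linarith [this.2]⟩
  set d := Vᴴ *ᵥ ψ₀ with hd
  set φ₀ := UI *ᵥ sysZero n with hφ₀
  set c := Vᴴ *ᵥ φ₀ with hc
  have hback : ∀ v, V *ᵥ (Vᴴ *ᵥ v) = v := fun v => by
    rw [Matrix.mulVec_mulVec, hV1, Matrix.one_mulVec]
  have hforth : ∀ v, Vᴴ *ᵥ (V *ᵥ v) = v := fun v => by
    rw [Matrix.mulVec_mulVec, hV2, Matrix.one_mulVec]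
  have hdiag : ∀ (z : SysBasis n → ℂ) (v : SysBasis n → ℂ),
      Vᴴ *ᵥ ((V * Matrix.diagonal z * Vᴴ) *ᵥ v) = fun i => z i * (Vᴴ *ᵥ v) i := fun z v => by
    rw [← Matrix.mulVec_mulVec, ← Matrix.mulVec_mulVec, hforth]
    funext i
    rw [Matrix.mulVec_diagonal]
  obtain ⟨i₀, hd1, hEi₀, hoff⟩ := exists_index_ground (E := E) (d := d) (E₀ := E₀) (E₁ := E₁)
    (by rw [hd, star_mulVec_dotProduct_mulVec hV', h.ground_norm])
    (fun i => by
      have h1 := congrArg (Vᴴ *ᵥ ·) h.ground_eigen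
      rw [hE, hdiag, Matrix.mulVec_smul] at h1
      exact congrFun h1 i)
    (by linarith [h.gap])
    (fun v e hv hdv hev => by
      refine h.excited_isLeast.2 ⟨V *ᵥ v, fun h0 => hv ?_, ?_, ?_⟩
      · rw [← hforth v, h0, Matrix.mulVec_zero]
      · rw [← hback ψ₀, star_mulVec_dotProduct_mulVec hV, ← hd, hdv]
      · rw [← hback (H *ᵥ (V *ᵥ v)), hE, hdiag, hforth, ← Matrix.mulVec_smul]
        congr 1
        funext i
        exact hev i)
  have hcc : ∑ i, ‖c i‖ ^ 2 = 1 := by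
    have h1 : star c ⬝ᵥ c = 1 := by
      rw [hc, star_mulVec_dotProduct_mulVec hV', hφ₀, star_mulVec_dotProduct_mulVec h.unitary,
        sysZero, ← Pi.single_star]
      simp
    rw [star_dotProduct_self_eq_sum] at h1
    exact_mod_cast h1
  set p : SysBasis n → ℂ := fun i => P.eval (Complex.exp (-(E i * Complex.I))) with hp
  set χ := aeval (evolution H) P *ᵥ φ₀ with hχ
  have hVχ : Vᴴ *ᵥ χ = fun i => p i * c i := by
    rw [hχ, evolution, hE, exp_conj_diagonal hV, aeval_conj_diagonal hV, hdiag]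
  have hχsum : ∑ y, ‖χ y‖ ^ 2 = ∑ i, ‖p i‖ ^ 2 * ‖c i‖ ^ 2 := by
    have h1 := star_mulVec_dotProduct_mulVec hV' χ χ
    rw [star_dotProduct_self_eq_sum, star_dotProduct_self_eq_sum, hVχ] at h1
    have h2 := Complex.ofReal_injective h1
    rw [← h2]
    exact Finset.sum_congr rfl fun i _ => by rw [norm_mul, mul_pow]
  have hsplit : ∀ f : SysBasis n → ℝ, ∑ i, f i = f i₀ + ∑ i ∈ Finset.univ.erase i₀, f i :=
    fun f => (Finset.add_sum_erase _ f (Finset.mem_univ i₀)).symm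
  have hsingle : ∀ v : SysBasis n → ℂ, ‖star d ⬝ᵥ v‖ = ‖v i₀‖ := fun v => by
    rw [dotProduct, Finset.sum_eq_single i₀]
    · rw [norm_mul, Pi.star_apply, norm_star, hd1, one_mul]
    · intro i _ hi
      rw [Pi.star_apply, (hoff i hi).1, star_zero, zero_mul]
    · simp
  have hover : ‖star ψ₀ ⬝ᵥ χ‖ = ‖p i₀‖ * ‖c i₀‖ := by
    rw [← star_mulVec_dotProduct_mulVec hV' ψ₀ χ, ← hd, hsingle, hVχ, norm_mul]
  have hγ : γ ≤ ‖c i₀‖ := by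
    refine h.overlap.trans (le_of_eq ?_)
    rw [← hφ₀, ← star_mulVec_dotProduct_mulVec hV' φ₀ ψ₀, ← hd, ← hc, ← hsingle,
      ← norm_star (star d ⬝ᵥ c), Matrix.star_dotProduct]
  have hp0 : 1 / 4 ≤ ‖p i₀‖ := hlarge _ (hrange i₀).1 (hrange i₀).2 (by rw [hEi₀]; exact h.energy_le)
  refine ⟨‖p i₀‖ * ‖c i₀‖, ?_, hover, ?_, ?_⟩
  · nlinarith [norm_nonneg (c i₀)]
  · rw [hχsum, hsplit, mul_pow]
    exact le_add_of_nonneg_right (Finset.sum_nonneg fun i _ => by positivity)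
  · rw [hχsum, hsplit, mul_pow]
    rw [hsplit] at hcc
    have h1 : ∑ i ∈ Finset.univ.erase i₀, ‖p i‖ ^ 2 * ‖c i‖ ^ 2 ≤
        ∑ i ∈ Finset.univ.erase i₀, (δ / 2) ^ 2 * ‖c i‖ ^ 2 := by
      refine Finset.sum_le_sum fun i hi => ?_
      have hi' := hoff i (Finset.ne_of_mem_erase hi)
      have h2 : ‖p i‖ ≤ δ / 2 := hsmall _ (hrange i).1 (hrange i).2 (h.le_excited.trans hi'.2)
      gcongr
    rw [← Finset.mul_sum] at h1
    have h3 : ∑ i ∈ Finset.univ.erase i₀, ‖c i‖ ^ 2 ≤ 1 := by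
      linarith [sq_nonneg ‖c i₀‖]
    nlinarith [sq_nonneg (δ / 2)]

/-- The overlap is `x / √W` with `√W ≤ x + εγ / 4 ≤ (1 + ε) x`, and `1 / (1 + ε) ≥ 1 - ε`. A leakage
proportional to `γ` is required since `x` may be as small as `γ / 4`. -/
theorem isPrepared_smul {ε x : ℝ} (hε0 : 0 < ε) (hε1 : ε < 1) (hγ : 0 < γ) (hx : γ / 4 ≤ x)
    {χ : SysBasis n → ℂ} (hover : ‖star ψ₀ ⬝ᵥ χ‖ = x) (hlow : x ^ 2 ≤ ∑ y, ‖χ y‖ ^ 2)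
    (hup : ∑ y, ‖χ y‖ ^ 2 ≤ x ^ 2 + (ε * γ / 2 / 2) ^ 2) (c : ℂ) :
    IsPrepared ε ψ₀ (c • withZeroAncilla 2 χ) := by
  have hx0 : 0 < x := by linarith
  set W := ∑ y, ‖χ y‖ ^ 2 with hW
  have hW0 : 0 < W := lt_of_lt_of_le (by positivity) hlow
  have hs0 : 0 < √W := Real.sqrt_pos.2 hW0
  have hsne : ((√W : ℝ) : ℂ) ≠ 0 := by exact_mod_cast hs0.ne'
  refine ⟨c * (√W : ℝ), ((√W : ℝ) : ℂ)⁻¹ • χ, ?_, ?_, ?_⟩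
  · funext y
    simp only [Pi.smul_apply, withZeroAncilla, smul_eq_mul]
    split_ifs
    · field_simp
    · simp
  · rw [star_dotProduct_self_eq_sum]
    have : ∑ y, ‖(((√W : ℝ) : ℂ)⁻¹ • χ) y‖ ^ 2 = (√W)⁻¹ ^ 2 * W := by
      rw [hW, Finset.mul_sum]
      refine Finset.sum_congr rfl fun y _ => ?_
      rw [Pi.smul_apply, smul_eq_mul, norm_mul, mul_pow, norm_inv, Complex.norm_real,
        Real.norm_eq_abs, abs_of_pos hs0]
    rw [this, inv_pow, Real.sq_sqrt hW0.le, inv_mul_cancel₀ hW0.ne', Complex.ofReal_one]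
  · rw [dotProduct_smul, smul_eq_mul, norm_mul, hover, norm_inv, Complex.norm_real,
      Real.norm_eq_abs, abs_of_pos hs0, inv_mul_eq_div, le_div_iff₀ hs0]
    have h1 : √W ≤ x + ε * γ / 4 := by
      rw [Real.sqrt_le_left (by positivity)]
      nlinarith [mul_pos hx0 (mul_pos hε0 hγ)]
    nlinarith [mul_pos hε0 hγ]

end Filtered

end

end GroundStatePrep

namespace GroundStatePrep

noncomputable section

/-! ### Choice of the parameters -/

theorem exists_amplification_depth {γ : ℝ} (hγ0 : 0 < γ) (hγ1 : γ ≤ 1) :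
    ∃ K : ℕ, Real.pi / 6 ≤ 3 ^ K * (γ / 4) ∧ (3 : ℝ) ^ K ≤ 7 * γ⁻¹ := by
  have hpi := Real.pi_gt_three
  have hpi' := Real.pi_lt_d2
  have hγ : γ * γ⁻¹ = 1 := mul_inv_cancel₀ hγ0.ne'
  have h1 : 1 ≤ γ⁻¹ := (one_le_inv₀ hγ0).2 hγ1
  -- The least admissible power is `2π / (3γ)`; rounding up to a power of `3` loses at most a factor
  -- `3`, and `2π < 7`.
  obtain ⟨K, hK1, hK2⟩ := exists_nat_pow_near (x := 2 * Real.pi / 3 * γ⁻¹) (y := 3)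
    (by nlinarith) (by norm_num)
  refine ⟨K + 1, ?_, ?_⟩
  · have : 2 * Real.pi / 3 * γ⁻¹ * (γ / 4) ≤ 3 ^ (K + 1) * (γ / 4) := by gcongr
    nlinarith
  · rw [pow_succ]
    nlinarith

/-- `N ≈ 4π / Δ` sets the width of the kernel and `m ≈ log₂ (2 N / (εγ))` its tail. The bound on `m`
is a product of logarithms because `log (2 / ε)` must appear as the factor allowed by the cost, and
the rest as a logarithm of `2 + g`. -/
theorem exists_filter_params {γ Δ ε : ℝ} (hγ0 : 0 < γ) (hγ1 : γ ≤ 1) (hΔ0 : 0 < Δ)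
    (hΔ : Δ ≤ Real.pi) (hε0 : 0 < ε) (hε1 : ε < 1) :
    ∃ N m : ℕ, 1 ≤ N ∧ 1 ≤ m ∧ 4 * Real.pi ≤ N * Δ ∧ (N : ℝ) ≤ ε * γ / 2 * 2 ^ m ∧
      (m * N : ℝ) ≤ 400 * Δ⁻¹ * (Real.log (2 / ε) *
        Real.log (2 + γ⁻¹ * Δ⁻¹ * Real.log (2 / ε))) := by
  have hpi := Real.pi_gt_three
  have hpi' := Real.pi_lt_d2
  have hl2 := Real.log_two_gt_d9
  have hl2' := Real.log_two_lt_d9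
  have hΔi : Δ * Δ⁻¹ = 1 := mul_inv_cancel₀ hΔ0.ne'
  have hΔi0 : 0 < Δ⁻¹ := inv_pos.2 hΔ0
  have hγi0 : 0 < γ⁻¹ := inv_pos.2 hγ0
  set L := Real.log (2 / ε) with hL
  have hL0 : Real.log 2 ≤ L := Real.log_le_log (by norm_num) (by
    rw [le_div_iff₀ hε0]; linarith)
  set g := γ⁻¹ * Δ⁻¹ * L with hg
  have hg0 : 0 < g := by
    have : 0 < L := by linarith
    positivity
  set Λ := Real.log (2 + g) with hΛ
  have hΛ0 : Real.log 2 ≤ Λ := Real.log_le_log (by norm_num) (by linarith)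
  set N := ⌈4 * Real.pi / Δ⌉₊ with hN
  have hN1 : 4 * Real.pi / Δ ≤ N := Nat.le_ceil _
  have hN2 : (N : ℝ) ≤ 16 * Δ⁻¹ := by
    -- Since `Δ ≤ π`, the `1` lost to rounding is at most `π / Δ`, and `5π < 16`.
    have h1 := (Nat.ceil_lt_add_one (by positivity : 0 ≤ 4 * Real.pi / Δ)).le
    have h2 : 4 * Real.pi / Δ = 4 * Real.pi * Δ⁻¹ := div_eq_mul_inv _ _
    rw [← hN, h2] at h1
    nlinarith
  have hNpos : 1 ≤ N := Nat.one_le_ceil_iff.2 (by positivity)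
  have hNpos' : (1 : ℝ) ≤ N := by exact_mod_cast hNpos
  set y : ℝ := N / (ε * γ / 2) with hy
  have hεγ : 0 < ε * γ / 2 := by positivity
  have hy1 : 1 ≤ y := by
    rw [hy, le_div_iff₀ hεγ]
    nlinarith
  obtain ⟨m, hm1, hm2⟩ := exists_nat_pow_near hy1 (one_lt_two : (1 : ℝ) < 2)
  have hlog : Real.log y ≤ 8 * (L * Λ) / Real.log 2 - Real.log 2 := by
    have hLpos : 0 < L := by linarith
    have h1 : y ≤ 32 * (g / L) * (1 / ε) := by
      rw [hy, div_le_iff₀ hεγ, hg]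
      have : 32 * (γ⁻¹ * Δ⁻¹ * L / L) * (1 / ε) * (ε * γ / 2) = 16 * Δ⁻¹ := by
        field_simp; norm_num
      rw [this]; exact hN2
    have h2 : g / L ≤ 2 * (2 + g) := by
      rw [div_le_iff₀ hLpos]; nlinarith
    have h3 : y ≤ 32 * (2 + g) * (2 / ε) := by
      refine h1.trans ?_
      have : 32 * (g / L) * (1 / ε) ≤ 32 * (2 * (2 + g)) * (1 / ε) := by gcongr
      refine this.trans (le_of_eq ?_)
      ring
    have h4 : Real.log y ≤ 5 * Real.log 2 + Λ + L := by
      refine (Real.log_le_log (by linarith) h3).trans (le_of_eq ?_)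
      rw [Real.log_mul (by positivity) (by positivity), Real.log_mul (by norm_num) (by positivity)]
      rw [show (32 : ℝ) = 2 ^ 5 by norm_num, Real.log_pow]
      push_cast; ring
    -- Both `L` and `Λ` are at least `log 2`, so each of the eight terms is at most `L * Λ / log 2`.
    -- The sixth `log 2` pays for rounding `m` up.
    have h5 : 6 * Real.log 2 + Λ + L ≤ 8 * (L * Λ) / Real.log 2 := by
      rw [le_div_iff₀ (by linarith)]
      have hl0 : 0 ≤ Real.log 2 := by linarith
      have e1 : Real.log 2 * Real.log 2 ≤ L * Λ := mul_le_mul hL0 hΛ0 hl0 hLpos.le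
      have e2 : Λ * Real.log 2 ≤ L * Λ := by
        rw [mul_comm]; exact mul_le_mul_of_nonneg_right hL0 (hl0.trans hΛ0)
      have e3 : L * Real.log 2 ≤ L * Λ := mul_le_mul_of_nonneg_left hΛ0 hLpos.le
      nlinarith
    linarith
  have hm3 : (m + 1 : ℝ) ≤ 25 * (L * Λ) := by
    have h1 : m * Real.log 2 ≤ Real.log y := by
      rw [← Real.log_pow]; exact Real.log_le_log (by positivity) hm1
    have h2 : (m + 1 : ℝ) * Real.log 2 ≤ 8 * (L * Λ) / Real.log 2 := by linarith
    rw [le_div_iff₀ (by linarith)] at h2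
    have h3 : (0.4 : ℝ) ≤ Real.log 2 * Real.log 2 := by nlinarith
    have h4 : (0 : ℝ) ≤ m := Nat.cast_nonneg m
    nlinarith
  refine ⟨N, m + 1, hNpos, Nat.succ_pos m, ?_, ?_, ?_⟩
  · rwa [div_le_iff₀ hΔ0] at hN1
  · have h1 := hm2.le
    rw [hy, div_le_iff₀ hεγ] at h1
    linarith
  · push_cast
    calc ((m : ℝ) + 1) * N ≤ (25 * (L * Λ)) * (16 * Δ⁻¹) := by
          gcongr
          exact le_trans (by positivity) hm3
      _ = 400 * Δ⁻¹ * (L * Λ) := by ring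

theorem exists_filter_sequence {γ Δ μ ε : ℝ} (hγ0 : 0 < γ) (hγ1 : γ ≤ 1) (hΔ0 : 0 < Δ)
    (hΔ : Δ ≤ Real.pi) (hε0 : 0 < ε) (hε1 : ε < 1) :
    ∃ l : List (Matrix.unitaryGroup (Fin 2) ℂ),
      (l.length : ℝ) ≤ 1200 * Δ⁻¹ * (Real.log (2 / ε) *
        Real.log (2 + γ⁻¹ * Δ⁻¹ * Real.log (2 / ε))) ∧
      (∀ t : ℝ, 0 ≤ t → t ≤ Real.pi → t ≤ μ - Δ / 2 →
        1 / 4 ≤ ‖(signalPair l).1.eval (Complex.exp (-(t * Complex.I)))‖) ∧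
      ∀ t : ℝ, 0 ≤ t → t ≤ Real.pi → μ + Δ / 2 ≤ t →
        ‖(signalPair l).1.eval (Complex.exp (-(t * Complex.I)))‖ ≤ ε * γ / 2 / 2 := by
  obtain ⟨N, m, hN1, hm1, hN, hm, hmN⟩ := exists_filter_params hγ0 hγ1 hΔ0 hΔ hε0 hε1
  obtain ⟨P, hPd, hP1, hlarge, hsmall⟩ := exists_lowPass (μ := μ) hΔ0 hΔ
    (by positivity : 0 < ε * γ / 2) (by nlinarith) hN hm
  obtain ⟨Q, hQd, hPQ⟩ := exists_complement hPd fun z hz => (hP1 z hz).trans_lt (by norm_num)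
  obtain ⟨l, hl, hlP⟩ := exists_signalPair_eq _ P Q hPd hQd hPQ
  have hP : (signalPair l).1 = P := by rw [hlP]
  rw [← hP] at hlarge hsmall
  refine ⟨l, ?_, hlarge, hsmall⟩
  rw [hl]
  -- The length `2 m N + 1` is at most `3 m N`, whence `1200 = 3 * 400`.
  have h1 : (1 : ℝ) ≤ m * N := by exact_mod_cast Nat.mul_pos hm1 hN1
  push_cast
  linarith

/-! ### The algorithm -/

theorem softBound_nonneg {C g : ℝ} (k : ℕ) (hC : 0 ≤ C) (hg : 0 ≤ g) : 0 ≤ softBound C k g :=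
  mul_nonneg (mul_nonneg hC hg) (pow_nonneg (Real.log_nonneg (by linarith)) k)

theorem prepares_sweeps {n : ℕ} (hn : 1 ≤ n) {η γ Δ μ ε : ℝ} (hη : 0 < η) (hγ0 : 0 < γ)
    (hΔ0 : 0 < Δ) (hε0 : 0 < ε) (hε1 : ε < 1) {l : List (Matrix.unitaryGroup (Fin 2) ℂ)}
    (hlarge : ∀ t : ℝ, 0 ≤ t → t ≤ Real.pi → t ≤ μ - Δ / 2 →
      1 / 4 ≤ ‖(signalPair l).1.eval (Complex.exp (-(t * Complex.I)))‖)
    (hsmall : ∀ t : ℝ, 0 ≤ t → t ≤ Real.pi → μ + Δ / 2 ≤ t →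
      ‖(signalPair l).1.eval (Complex.exp (-(t * Complex.I)))‖ ≤ ε * γ / 2 / 2) {K : ℕ}
    (hK : Real.pi / 6 ≤ 3 ^ K * (γ / 4)) {H UI : Matrix (SysBasis n) (SysBasis n) ℂ}
    {ψ₀ : SysBasis n → ℂ} {E₀ E₁ : ℝ} (h : IsInstance η γ Δ μ H UI ψ₀ E₀ E₁) :
    (attempts (sweeps (filterOps l) K)).Prepares (evolution H) UI ε (2 / 3) ψ₀ := by
  obtain ⟨x, hx, hover, hlow, hup⟩ := h.filtered hΔ0 hη hlarge hsmall
  have hU := evolution_mem_unitaryGroup h.hermitian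
  have hkeep : KeepsSpare (evolution H) UI (filterOps l) := keepsSpare_filterOps l
  refine ⟨successProb_sweeps hn hU h.unitary hkeep (s := γ / 4) (by positivity) ?_ hK,
    successImplies_sweeps hn hU h.unitary hkeep (fun c => ?_) K _⟩
  · rw [goodWeight, goodPart_runOps_filterOps, weight_withZeroAncilla]
    exact le_trans (by gcongr) hlow
  · rw [goodPart_runOps_filterOps]
    exact isPrepared_smul hε0 hε1 hγ0 hx hover hlow hup c

theorem uQueries_sweeps_le {n : ℕ} (l : List (Matrix.unitaryGroup (Fin 2) ℂ)) (K : ℕ) :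
    (attempts (sweeps (filterOps (n := n) l) K)).uQueries ≤ 6 * 3 ^ K * l.length := by
  refine (cost_sweeps_le Op.uCost_inverse 0 0 (r := 0) ?_ _ K).trans (le_of_eq ?_)
  · simp [Op.uCost, (gatesOnly_zeroReflection n).1]
  · rw [filterOps, opsCost_cons, opsCost_signalOps _ 1 0 rfl fun _ => rfl]
    simp [Op.uCost]

theorem uiQueries_sweeps_le {n : ℕ} (l : List (Matrix.unitaryGroup (Fin 2) ℂ)) (K : ℕ) :
    (attempts (sweeps (filterOps (n := n) l) K)).uiQueries ≤ 6 * 3 ^ K := by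
  refine (cost_sweeps_le Op.uiCost_inverse 0 0 (r := 0) ?_ _ K).trans (le_of_eq ?_)
  · simp [Op.uiCost, (gatesOnly_zeroReflection n).2.1]
  · rw [filterOps, opsCost_cons, opsCost_signalOps _ 0 0 rfl fun _ => rfl]
    simp [Op.uiCost]

theorem extraGates_sweeps_le {n : ℕ} (hn : 1 ≤ n) (l : List (Matrix.unitaryGroup (Fin 2) ℂ))
    (K : ℕ) : (attempts (sweeps (filterOps (n := n) l) K)).extraGates ≤
      6 * 3 ^ K * (l.length + 89 * n) := by
  refine (cost_sweeps_le Op.gateCost_inverse 1 (2 + n) (r := 40 * n + 45) ?_ _ K).trans ?_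
  · have := (gatesOnly_zeroReflection n).2.2
    simp only [Op.gateCost]; omega
  · rw [filterOps, opsCost_cons, opsCost_signalOps _ 0 1 rfl fun _ => rfl]
    simp only [Op.gateCost]
    -- Per unit: the rotations, `40 n + 45` gates for both reflections, and `n + 3` for measurement
    -- and restart. `41 n + 48 ≤ 89 n` uses `1 ≤ n`.
    exact Nat.mul_le_mul_left _ (by omega)

end

end GroundStatePrep

/-! ### Assembly of the bounds -/

open GroundStatePrep in
theorem theorem5 :
    ∃ (C : ℝ) (k : ℕ), 0 < C ∧
      ∀ (n : ℕ) (η γ Δ μ ε : ℝ), 1 ≤ n → 0 < η → 0 < γ → γ ≤ 1 → 0 < Δ → 0 < ε → ε < 1 →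
        ∃ P : GroundStatePrep.Program 2 n,
          (P.uQueries : ℝ) ≤ GroundStatePrep.softBound C k (γ⁻¹ * Δ⁻¹ * Real.log (2 / ε)) ∧
          (P.uiQueries : ℝ) ≤ C * γ⁻¹ ∧
          (P.extraGates : ℝ) ≤
            GroundStatePrep.softBound C k (n * γ⁻¹ * Δ⁻¹ * Real.log (2 / ε)) ∧
          (P.uDepth : ℝ) ≤ GroundStatePrep.softBound C k (γ⁻¹ * Δ⁻¹ * Real.log (2 / ε)) ∧
          ∀ (H UI : Matrix (GroundStatePrep.SysBasis n) (GroundStatePrep.SysBasis n) ℂ)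
            (ψ₀ : GroundStatePrep.SysBasis n → ℂ) (E₀ E₁ : ℝ),
            GroundStatePrep.IsInstance η γ Δ μ H UI ψ₀ E₀ E₁ →
              P.Prepares (GroundStatePrep.evolution H) UI ε (2 / 3) ψ₀ := by
  refine ⟨100000, 1, by norm_num, fun n η γ Δ μ ε hn hη hγ0 hγ1 hΔ0 hε0 hε1 => ?_⟩
  have hl2 := Real.log_two_gt_d9
  have hγi0 : 0 < γ⁻¹ := inv_pos.2 hγ0
  have hΔi0 : 0 < Δ⁻¹ := inv_pos.2 hΔ0
  have hn1 : (1 : ℝ) ≤ n := by exact_mod_cast hn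
  have hL0 : Real.log 2 ≤ Real.log (2 / ε) := Real.log_le_log (by norm_num) (by
    rw [le_div_iff₀ hε0]; linarith)
  have hLpos : 0 < Real.log (2 / ε) := by linarith
  -- For `Δ > π` there are no instances, and the program that fails at once satisfies every bound.
  by_cases hΔ : Real.pi < Δ
  · refine ⟨.halt false, ?_, ?_, ?_, ?_, fun H UI ψ₀ E₀ E₁ h => ?_⟩
    · simpa [Program.uQueries, Program.cost] using
        softBound_nonneg 1 (by norm_num) (by positivity)
    · simp only [Program.uiQueries, Program.cost, Nat.cast_zero]
      positivity
    · simpa [Program.extraGates, Program.cost] using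
        softBound_nonneg 1 (by norm_num) (by positivity)
    · simpa [Program.uDepth, Program.uDepthFrom] using
        softBound_nonneg 1 (by norm_num) (by positivity)
    · exact absurd (h.gap_le_pi hη) (not_le.2 hΔ)
  · rw [not_lt] at hΔ
    obtain ⟨K, hK, hK'⟩ := exists_amplification_depth hγ0 hγ1
    obtain ⟨l, hl, hlarge, hsmall⟩ := exists_filter_sequence (μ := μ) hγ0 hγ1 hΔ0 hΔ hε0 hε1
    set L := Real.log (2 / ε) with hL
    set g := γ⁻¹ * Δ⁻¹ * L with hg
    have hg0 : 0 < g := by positivity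
    have hΛ0 : Real.log 2 ≤ Real.log (2 + g) := Real.log_le_log (by norm_num) (by linarith)
    have hbase : 6 * (3 : ℝ) ^ K * l.length ≤ 50400 * g * Real.log (2 + g) := by
      calc 6 * (3 : ℝ) ^ K * l.length ≤
            6 * (7 * γ⁻¹) * (1200 * Δ⁻¹ * (L * Real.log (2 + g))) := by gcongr
        _ = 50400 * g * Real.log (2 + g) := by rw [hg]; ring
    have hu : ((attempts (sweeps (filterOps (n := n) l) K)).uQueries : ℝ) ≤
        softBound 100000 1 g := by
      have h1 : ((attempts (sweeps (filterOps (n := n) l) K)).uQueries : ℝ) ≤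
          6 * (3 : ℝ) ^ K * l.length := by exact_mod_cast uQueries_sweeps_le l K
      rw [softBound, pow_one]
      have h2 : 0 ≤ g * Real.log (2 + g) := mul_nonneg hg0.le (by linarith)
      nlinarith
    refine ⟨attempts (sweeps (filterOps l) K), hu, ?_, ?_, ?_, fun H UI ψ₀ E₀ E₁ h =>
      prepares_sweeps hn hη hγ0 hΔ0 hε0 hε1 hlarge hsmall hK h⟩
    · have h1 : ((attempts (sweeps (filterOps (n := n) l) K)).uiQueries : ℝ) ≤
          6 * (3 : ℝ) ^ K := by exact_mod_cast uiQueries_sweeps_le l K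
      linarith
    · have h1 : ((attempts (sweeps (filterOps (n := n) l) K)).extraGates : ℝ) ≤
          6 * (3 : ℝ) ^ K * (l.length + 89 * n) := by exact_mod_cast extraGates_sweeps_le hn l K
      have hgn : (n : ℝ) * γ⁻¹ * Δ⁻¹ * L = n * g := by rw [hg]; ring
      rw [hgn, softBound, pow_one]
      have hgg : g ≤ n * g := le_mul_of_one_le_left hg0.le hn1
      have hΛn : Real.log (2 + g) ≤ Real.log (2 + n * g) :=
        Real.log_le_log (by linarith) (by linarith)
      have h2 : g * Real.log (2 + g) ≤ n * g * Real.log (2 + n * g) :=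
        mul_le_mul hgg hΛn (by linarith) (by positivity)
      -- The gates for reflections and restarts number `O(n γ⁻¹)`, without a factor `Δ⁻¹ log (2 /
      -- ε)`. This factor is bounded below, since `Δ ≤ π` and `log (2 / ε) ≥ log 2`, so it can be
      -- inserted.
      have h3 : γ⁻¹ ≤ 5 * g := by
        have h4 : 1 ≤ 5 * (Δ⁻¹ * L) := by
          have h5 : Real.pi⁻¹ ≤ Δ⁻¹ := inv_anti₀ hΔ0 hΔ
          have h6 : (1 / 3.15 : ℝ) ≤ Real.pi⁻¹ := by
            rw [one_div]
            exact inv_anti₀ Real.pi_pos Real.pi_lt_d2.le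
          have h7 : (1 / 3.15 : ℝ) * 0.693 ≤ Δ⁻¹ * L :=
            mul_le_mul (h6.trans h5) (by linarith) (by norm_num) hΔi0.le
          norm_num at h7
          linarith
        have := mul_le_mul_of_nonneg_left h4 hγi0.le
        rw [hg]; linarith
      have h4 : 6 * (3 : ℝ) ^ K * (89 * n) ≤ 18690 * (n * g) := by
        calc 6 * (3 : ℝ) ^ K * (89 * n) ≤ 6 * (7 * (5 * g)) * (89 * n) := by
              gcongr; exact hK'.trans (by linarith)
          _ = 18690 * (n * g) := by ring
      have h5 : 18690 * (n * g) ≤ 40000 * (n * g * Real.log (2 + n * g)) := by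
        have h6 : 0 ≤ n * g := by positivity
        have h7 : n * g * 0.6 ≤ n * g * Real.log (2 + n * g) :=
          mul_le_mul_of_nonneg_left (by linarith) h6
        linarith
      have h6 : 0 ≤ n * g * Real.log (2 + n * g) := mul_nonneg (by positivity) (by linarith)
      linarith
    -- No coherent run makes more queries than the whole program.
    · exact le_trans (by exact_mod_cast Program.uDepth_le_uQueries _) hu
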